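/- Let $k$ be an algebraically closed field and $n\ge 0$ an integer. Let $$Comm_n=\{(X,Y)\in gl_n\oplus gl_n \mid [X,Y]=0\},$$ where $gl_n$ denotes the $n\times n$ matrices over $k$; it is the closed subscheme of $gl_n\oplus gl_n$ defined by the entries of $XY-YX$. Let $T_n\subset GL_n$ be the torus of diagonal matrices, and let $T=T_n\times\mathbb{G}_m\times\mathbb{G}_m$ act on $gl_n\oplus gl_n$ and on $Comm_n$ by $$(g,t_1,t_2)\cdot(X,Y)=(t_1\,gXg^{-1},\,t_2\,gYg^{-1}).$$ For a $T$-scheme $Z$ let $K^T(Z)$ be the Grothendieck group of $T$-equivariant coherent sheaves on $Z$. Identify $K^T(\mathrm{Spec}\,k)=\mathrm{Rep}(T)$ with $\mathbb{Z}[q_1^{\pm1},q_2^{\pm1}][z_1^{\pm1},\ldots,z_n^{\pm1}]$, where $z_i$, $q_1$, $q_2$ are the classes of the characters $(g,t_1,t_2)\mapsto g_{ii},\ t_1,\ t_2$. Let $p:Comm_n\to gl_n\oplus gl_n$ be the inclusion, and let $r_0:\mathrm{Spec}\,k\to gl_n\oplus gl_n$ be the inclusion of the origin. Then $$r_0^*[\mathcal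 F]=\sum_{i\ge0}(-1)^i\,[\mathrm{Tor}_i^{\mathcal O_{gl_n\oplus gl_n}}(\mathcal O_{0},\mathcal F)]$$ defines a homomorphism $r_0^*:K^T(gl_n\oplus gl_n)\to K^T(\mathrm{Spec}\,k)$, and for any three distinct indices $i,j,l\in\{1,\ldots,n\}$ the image of $$r_0^*\circ p_*:K^T(Comm_n)\to \mathbb{Z}[q_1^{\pm1},q_2^{\pm1}][z_1^{\pm1},\ldots,z_n^{\pm1}]$$ is contained both in the ideal $(z_l-q_1z_j,\ z_j-q_2z_i)$ and in the ideal $(z_l-q_2z_j,\ z_j-q_1z_i)$. -/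

import Mathlib

open scoped TensorProduct

noncomputable section

namespace WheelCondition

universe u

/-! ### The torus `T_n × 𝔾_m × 𝔾_m`, its characters and its representation ring -/

/-- The group of `k`-points of the torus `T_n × 𝔾_m × 𝔾_m`: an element is `(g, t₁, t₂)`, where
`g` is the list of entries of an invertible diagonal matrix. (`k` will be algebraically closed, so
that the torus is determined by its `k`-points.) -/
abbrev Torus (n : ℕ) (k : Type u) [Field k] : Type u := (Fin n → kˣ) × kˣ × kˣ

/-- The character lattice of the torus. -/
abbrev Weight (n : ℕ) : Type := (Fin n → ℤ) × ℤ × ℤ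

/-- The value at `t` of the character with exponents `χ`. -/
def Weight.eval {n : ℕ} {k : Type u} [Field k] (χ : Weight n) (t : Torus n k) : kˣ :=
  (∏ i, t.1 i ^ χ.1 i) * t.2.1 ^ χ.2.1 * t.2.2 ^ χ.2.2

/-- The Laurent polynomial ring `ℤ[q₁^{±1}, q₂^{±1}][z₁^{±1}, …, z_n^{±1}]`, i.e. the
representation ring of the torus: the group ring of the character lattice. -/
abbrev RepRing (n : ℕ) : Type := AddMonoidAlgebra ℤ (Weight n)

/-- The variable `z_i`, i.e. the class of the character `(g, t₁, t₂) ↦ g_i`. -/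
def z {n : ℕ} (i : Fin n) : RepRing n := AddMonoidAlgebra.single (Pi.single i 1, 0, 0) 1

/-- The variable `q₁`, i.e. the class of the character `(g, t₁, t₂) ↦ t₁`. -/
def q₁ {n : ℕ} : RepRing n := AddMonoidAlgebra.single (0, 1, 0) 1

/-- The variable `q₂`, i.e. the class of the character `(g, t₁, t₂) ↦ t₂`. -/
def q₂ {n : ℕ} : RepRing n := AddMonoidAlgebra.single (0, 0, 1) 1

section Character

variable {n : ℕ} {k : Type u} [Field k] {V : Type u} [AddCommGroup V] [Module k V]

/-- The weight space of weight `χ` of a representation of the torus. -/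
def weightSpace (ρ : Representation k (Torus n k) V) (χ : Weight n) : Submodule k V where
  carrier := {v | ∀ t, ρ t v = (χ.eval t : k) • v}
  add_mem' ha hb t := by rw [map_add, ha t, hb t, smul_add]
  zero_mem' t := by simp
  smul_mem' c v hv t := by rw [map_smul, hv t, smul_comm]

/-- The class `∑_χ dim(V_χ) χ` in the representation ring of a finite-dimensional algebraic
representation `V` of the torus. -/
def ch (ρ : Representation k (Torus n k) V) : RepRing n :=
  ∑ᶠ χ : Weight n, AddMonoidAlgebra.single χ (Module.finrank k (weightSpace ρ χ) : ℤ)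

end Character

/-! ### Equivariant coherent sheaves on affine schemes and their Grothendieck group

Let the torus act on `Spec A`; write `α t f` for the induced left action on functions,
`(α t f)(x) = f (t⁻¹ x)`. -/

section Equivariant

variable {n : ℕ} {k : Type u} [Field k]

/-- A (not necessarily finitely generated) `A`-module with a compatible action of the torus. -/
structure EqModule {A : Type u} [CommRing A] [Algebra k A] (α : Torus n k →* (A →ₐ[k] A)) :
    Type (u + 1) where
  carrier : Type u
  [addCommGroup : AddCommGroup carrier]
  [moduleBase : Module k carrier]
  [module : Module A carrier]
  [tower : IsScalarTower k A carrier]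
  rho : Representation k (Torus n k) carrier
  rho_smul : ∀ t (a : A) (m : carrier), rho t (a • m) = α t a • rho t m

attribute [instance] EqModule.addCommGroup EqModule.moduleBase EqModule.module EqModule.tower

/-- A torus-equivariant coherent sheaf on `Spec A`: a finitely generated `A`-module with a
compatible action of the torus which is algebraic, i.e. every orbit map `t ↦ t • m` is a
regular function on the torus (a Laurent polynomial in `t` with coefficients in the module). -/
structure EqCoh {A : Type u} [CommRing A] [Algebra k A] (α : Torus n k →* (A →ₐ[k] A)) :
    Type (u + 1) extends EqModule α where
  finite : Module.Finite A carrier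
  algebraic : ∀ m : carrier, ∃ c : Weight n →₀ carrier,
    ∀ t, rho t m = c.sum fun χ v => (χ.eval t : k) • v

variable {A : Type u} [CommRing A] [Algebra k A] {α : Torus n k →* (A →ₐ[k] A)}

/-- There is a short exact sequence `0 → F → G → H → 0` of equivariant modules. -/
def IsShortExact (F G H : EqModule α) : Prop :=
  ∃ (f : F.carrier →ₗ[A] G.carrier) (g : G.carrier →ₗ[A] H.carrier),
    (∀ t m, f (F.rho t m) = G.rho t (f m)) ∧ (∀ t m, g (G.rho t m) = H.rho t (g m)) ∧
    Function.Injective f ∧ Function.Exact f g ∧ Function.Surjective g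

variable (α) in
/-- The relations `[G] = [F] + [H]` of the Grothendieck group. -/
def relations : AddSubgroup (FreeAbelianGroup (EqCoh α)) :=
  AddSubgroup.closure {x | ∃ F G H : EqCoh α,
    IsShortExact F.toEqModule G.toEqModule H.toEqModule ∧
    x = FreeAbelianGroup.of G - FreeAbelianGroup.of F - FreeAbelianGroup.of H}

variable (α) in
/-- The Grothendieck group of equivariant coherent sheaves on `Spec A`. -/
abbrev KGroup : Type (u + 1) := FreeAbelianGroup (EqCoh α) ⧸ relations α

/-- The class of an equivariant coherent sheaf. -/
def KGroup.cls (F : EqCoh α) : KGroup α := QuotientAddGroup.mk (FreeAbelianGroup.of F)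

/-! ### Pushforward along equivariant closed immersions -/

section Pushforward

variable {B : Type u} [CommRing B] [Algebra k B] {β : Torus n k →* (B →ₐ[k] B)}
  (φ : A →ₐ[k] B) (hφ : Function.Surjective φ) (hαβ : ∀ t a, φ (α t a) = β t (φ a))

/-- Direct image of an equivariant coherent sheaf along the equivariant closed immersion
`Spec B → Spec A` given by `φ`: restriction of scalars. -/
@[reducible]
def pushforwardObj (F : EqCoh β) : EqCoh α :=
  letI : Module A F.carrier := Module.compHom F.carrier φ.toRingHom
  { carrier := F.carrier
    tower := ⟨fun c a m => by
      change φ (c • a) • m = c • (φ a • m)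
      rw [map_smul, smul_assoc]⟩
    rho := F.rho
    rho_smul := fun t a m => by
      change F.rho t (φ a • m) = φ (α t a) • F.rho t m
      rw [F.rho_smul, hαβ]
    finite := by
      obtain ⟨s, hs⟩ := F.finite
      refine ⟨s, ?_⟩
      rw [eq_top_iff]
      rintro m -
      have hm : m ∈ Submodule.span B (s : Set F.carrier) := by rw [hs]; trivial
      induction hm using Submodule.span_induction with
      | mem x hx => exact Submodule.subset_span hx
      | zero => exact Submodule.zero_mem _
      | add x y _ _ hx hy => exact Submodule.add_mem _ hx hy
      | smul b x _ hx =>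
        obtain ⟨a, rfl⟩ := hφ b
        exact Submodule.smul_mem _ a hx
    algebraic := F.algebraic }

theorem pushforwardObj_isShortExact {F G H : EqCoh β}
    (h : IsShortExact F.toEqModule G.toEqModule H.toEqModule) :
    IsShortExact (pushforwardObj φ hφ hαβ F).toEqModule (pushforwardObj φ hφ hαβ G).toEqModule
      (pushforwardObj φ hφ hαβ H).toEqModule := by
  obtain ⟨f, g, hf, hg, hi, he, hs⟩ := h
  let f' : (pushforwardObj φ hφ hαβ F).carrier →ₗ[A] (pushforwardObj φ hφ hαβ G).carrier :=
    { toFun := f, map_add' := f.map_add, map_smul' := fun a m => f.map_smul (φ a) m }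
  let g' : (pushforwardObj φ hφ hαβ G).carrier →ₗ[A] (pushforwardObj φ hφ hαβ H).carrier :=
    { toFun := g, map_add' := g.map_add, map_smul' := fun a m => g.map_smul (φ a) m }
  exact ⟨f', g', hf, hg, hi, he, hs⟩

/-- Pushforward on Grothendieck groups along the equivariant closed immersion given by `φ`. -/
def pushforward : KGroup β →+ KGroup α :=
  QuotientAddGroup.map (relations β) (relations α)
    (FreeAbelianGroup.map (pushforwardObj φ hφ hαβ)) <| by
      rw [relations, AddSubgroup.closure_le]
      rintro x ⟨F, G, H, h, rfl⟩
      refine AddSubgroup.subset_closure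
        ⟨_, _, _, pushforwardObj_isShortExact φ hφ hαβ h, ?_⟩
      simp [FreeAbelianGroup.map_of_apply]

end Pushforward

/-! ### Equivariant `Tor` at a fixed point

`Tor_i^A(k, M)` is computed by the canonical equivariant free resolution
`⋯ → A ⊗ Ω²M → A ⊗ ΩM → A ⊗ M → M → 0`, where the tensor products are over `k` and
`ΩN` is the kernel of `A ⊗ N → N`. -/

variable (α) in
/-- The action on functions as a linear representation. -/
def funRep : Representation k (Torus n k) A where
  toFun t := (α t).toLinearMap
  map_one' := by rw [map_one]; rfl
  map_mul' s t := by rw [map_mul]; rfl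

/-- The free `A`-module `A ⊗ N` on the `k`-vector space `N`, with the diagonal action. -/
@[reducible]
def EqModule.free (N : EqModule α) : EqModule α where
  carrier := A ⊗[k] N.carrier
  rho := (funRep α).tprod N.rho
  rho_smul t a m := by
    induction m using TensorProduct.induction_on with
    | zero => simp
    | tmul x y => simp [TensorProduct.smul_tmul', funRep]
    | add x y hx hy => rw [smul_add, map_add, hx, hy, map_add, smul_add]

/-- The equivariant surjection `A ⊗ N → N`, `a ⊗ m ↦ a m`. -/
def EqModule.aug (N : EqModule α) : N.free.carrier →ₗ[A] N.carrier :=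
  LinearMap.liftBaseChange A (LinearMap.id : N.carrier →ₗ[k] N.carrier)

theorem EqModule.aug_rho (N : EqModule α) (t : Torus n k) (x : N.free.carrier) :
    N.aug (N.free.rho t x) = N.rho t (N.aug x) := by
  induction x using TensorProduct.induction_on with
  | zero => simp
  | tmul a m => simp [EqModule.aug, funRep, N.rho_smul]
  | add x y hx hy => rw [map_add, map_add, hx, hy, map_add, map_add]

/-- The first syzygy `ΩN`: the kernel of `A ⊗ N → N`. -/
@[reducible]
def EqModule.syz (N : EqModule α) : EqModule α where
  carrier := LinearMap.ker N.aug
  rho :=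
    { toFun := fun t =>
        { toFun := fun x => ⟨N.free.rho t x.1, by
            rw [LinearMap.mem_ker, N.aug_rho, LinearMap.mem_ker.1 x.2, map_zero]⟩
          map_add' := fun x y => Subtype.ext (map_add (N.free.rho t) x.1 y.1)
          map_smul' := fun c x => Subtype.ext (map_smul (N.free.rho t) c x.1) }
      map_one' := LinearMap.ext fun x => Subtype.ext (by
        change N.free.rho 1 x.1 = x.1
        rw [map_one]; rfl)
      map_mul' := fun s t => LinearMap.ext fun x => Subtype.ext (by
        change N.free.rho (s * t) x.1 = N.free.rho s (N.free.rho t x.1)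
        rw [map_mul]; rfl) }
  rho_smul t a m := Subtype.ext (N.free.rho_smul t a m.1)

/-- The `i`-th syzygy `Ω^i M`. -/
def EqModule.syzygy (M : EqModule α) : ℕ → EqModule α
  | 0 => M
  | i + 1 => (M.syzygy i).syz

/-- The `i`-th term `A ⊗ Ω^i M` of the canonical free resolution of `M`. -/
abbrev EqModule.res (M : EqModule α) (i : ℕ) : EqModule α := (M.syzygy i).free

/-- The differential `A ⊗ Ω^{i+1} M → Ω^{i+1} M ⊆ A ⊗ Ω^i M` of the canonical free resolution. -/
def EqModule.resD (M : EqModule α) (i : ℕ) : (M.res (i + 1)).carrier →ₗ[A] (M.res i).carrier :=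
  (LinearMap.ker (M.syzygy i).aug).subtype ∘ₗ (M.syzygy (i + 1)).aug

theorem EqModule.resD_rho (M : EqModule α) (i : ℕ) (t : Torus n k) (x : (M.res (i + 1)).carrier) :
    M.resD i ((M.res (i + 1)).rho t x) = (M.res i).rho t (M.resD i x) :=
  congrArg Subtype.val ((M.syzygy (i + 1)).aug_rho t x)

section Fibre

variable (ε : A →ₐ[k] k)

/-- The subspace `𝔪N`, where `𝔪` is the maximal ideal of the point. -/
def EqModule.maxSMul (N : EqModule α) : Submodule k N.carrier :=
  (RingHom.ker ε • (⊤ : Submodule A N.carrier)).restrictScalars k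

/-- The fibre `N ⧸ 𝔪N = k ⊗_A N` of `N` at the point. -/
abbrev EqModule.Fibre (N : EqModule α) : Type u := N.carrier ⧸ N.maxSMul ε

variable {ε}

theorem EqModule.maxSMul_le (hε : ∀ t a, ε (α t a) = ε a) (N : EqModule α) (t : Torus n k) :
    N.maxSMul ε ≤ (N.maxSMul ε).comap (N.rho t) := by
  intro x hx
  change x ∈ RingHom.ker ε • (⊤ : Submodule A N.carrier) at hx
  change N.rho t x ∈ RingHom.ker ε • (⊤ : Submodule A N.carrier)
  refine Submodule.smul_induction_on hx (fun a ha m _ => ?_) (fun x y hx hy => ?_)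
  · rw [N.rho_smul]
    refine Submodule.smul_mem_smul ?_ trivial
    rw [RingHom.mem_ker] at ha ⊢
    exact (hε t a).trans ha
  · rw [map_add]; exact Submodule.add_mem _ hx hy

variable (hε : ∀ t a, ε (α t a) = ε a)

/-- The action of the torus on the fibre at a fixed point. -/
def EqModule.fibreRep (N : EqModule α) : Representation k (Torus n k) (N.Fibre ε) :=
  N.rho.quotient (N.maxSMul ε) (N.maxSMul_le hε)

variable (ε) in
/-- The differential of the complex of fibres `k ⊗_A (A ⊗ Ω^• M)`. -/
def EqModule.fibreD (M : EqModule α) (i : ℕ) :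
    (M.res (i + 1)).Fibre ε →ₗ[k] (M.res i).Fibre ε :=
  Submodule.mapQ _ _ ((M.resD i).restrictScalars k) fun x hx => by
    change x ∈ RingHom.ker ε • (⊤ : Submodule A _) at hx
    change M.resD i x ∈ RingHom.ker ε • (⊤ : Submodule A _)
    have := Submodule.mem_map_of_mem (f := M.resD i) hx
    rw [Submodule.map_smul''] at this
    exact Submodule.smul_mono le_rfl le_top this

theorem EqModule.fibreD_rho (M : EqModule α) (i : ℕ) (t : Torus n k)
    (x : (M.res (i + 1)).Fibre ε) :
    M.fibreD ε i ((M.res (i + 1)).fibreRep hε t x) =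
      (M.res i).fibreRep hε t (M.fibreD ε i x) := by
  obtain ⟨x, rfl⟩ := Submodule.Quotient.mk_surjective _ x
  exact congrArg Submodule.Quotient.mk (M.resD_rho i t x)

variable (ε) in
/-- The `i`-cycles of the complex of fibres. -/
def EqModule.cycles (M : EqModule α) : ∀ i : ℕ, Submodule k ((M.res i).Fibre ε)
  | 0 => ⊤
  | i + 1 => LinearMap.ker (M.fibreD ε i)

variable (ε) in
/-- The `i`-boundaries of the complex of fibres. -/
def EqModule.boundaries (M : EqModule α) (i : ℕ) : Submodule k ((M.res i).Fibre ε) :=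
  LinearMap.range (M.fibreD ε i)

theorem EqModule.cycles_le (M : EqModule α) (i : ℕ) (t : Torus n k) :
    M.cycles ε i ≤ (M.cycles ε i).comap ((M.res i).fibreRep hε t) := by
  cases i with
  | zero => exact fun _ _ => trivial
  | succ i =>
    intro x hx
    change M.fibreD ε i _ = 0
    rw [M.fibreD_rho, show M.fibreD ε i x = 0 from hx, map_zero]

theorem EqModule.boundaries_le (M : EqModule α) (i : ℕ) (t : Torus n k) :
    M.boundaries ε i ≤ (M.boundaries ε i).comap ((M.res i).fibreRep hε t) := by
  rintro _ ⟨x, rfl⟩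
  exact ⟨_, M.fibreD_rho hε i t x⟩

variable (ε) in
/-- The vector space `Tor_i^A(k, M)`: cycles modulo boundaries of the complex of fibres. -/
abbrev EqModule.Tor (M : EqModule α) (i : ℕ) : Type u :=
  M.cycles ε i ⧸ (M.boundaries ε i).comap (M.cycles ε i).subtype

/-- The action of the torus on `Tor_i^A(k, M)`. -/
def EqModule.torRep (M : EqModule α) (i : ℕ) : Representation k (Torus n k) (M.Tor ε i) :=
  (((M.res i).fibreRep hε).subrepresentation (M.cycles ε i) (M.cycles_le hε i)).quotient
    ((M.boundaries ε i).comap (M.cycles ε i).subtype)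
    fun t _ hx => M.boundaries_le hε i t hx

/-- The class `∑_i (-1)^i [Tor_i^A(k, M)]` in the representation ring. -/
def EqModule.torClass (M : EqModule α) : RepRing n :=
  ∑ᶠ i : ℕ, (-1) ^ i * ch (M.torRep hε i)

end Fibre

end Equivariant

/-! ### Pairs of matrices and the commuting variety -/

section Commuting

variable (n : ℕ) (k : Type u) [Field k]

variable {n k} in
/-- The action of `(g, t₁, t₂)` on pairs of matrices with entries in a `k`-algebra `B`:
`(X, Y) ↦ (t₁ g X g⁻¹, t₂ g Y g⁻¹)`. -/
def matAct {B : Type u} [CommRing B] [Algebra k B] (t : Torus n k)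
    (P : Matrix (Fin n) (Fin n) B × Matrix (Fin n) (Fin n) B) :
    Matrix (Fin n) (Fin n) B × Matrix (Fin n) (Fin n) B :=
  let g : Matrix (Fin n) (Fin n) B := Matrix.diagonal fun i => algebraMap k B (t.1 i)
  let g' : Matrix (Fin n) (Fin n) B := Matrix.diagonal fun i => algebraMap k B ↑(t.1 i)⁻¹
  ((t.2.1 : k) • (g * P.1 * g'), (t.2.2 : k) • (g * P.2 * g'))

variable {n k} in
theorem matAct_fst {B : Type u} [CommRing B] [Algebra k B] (t : Torus n k)
    (P : Matrix (Fin n) (Fin n) B × Matrix (Fin n) (Fin n) B) (i j : Fin n) :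
    (matAct t P).1 i j = algebraMap k B (t.2.1 * (t.1 i * ↑(t.1 j)⁻¹)) * P.1 i j := by
  simp only [matAct, Matrix.smul_apply, Matrix.mul_diagonal, Matrix.diagonal_mul]
  rw [Algebra.smul_def, map_mul, map_mul]
  ring

variable {n k} in
theorem matAct_snd {B : Type u} [CommRing B] [Algebra k B] (t : Torus n k)
    (P : Matrix (Fin n) (Fin n) B × Matrix (Fin n) (Fin n) B) (i j : Fin n) :
    (matAct t P).2 i j = algebraMap k B (t.2.2 * (t.1 i * ↑(t.1 j)⁻¹)) * P.2 i j := by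
  simp only [matAct, Matrix.smul_apply, Matrix.mul_diagonal, Matrix.diagonal_mul]
  rw [Algebra.smul_def, map_mul, map_mul]
  ring

/-- The coordinate ring of `gl_n ⊕ gl_n`. -/
abbrev MatRing : Type u := MvPolynomial ((Fin n × Fin n) ⊕ (Fin n × Fin n)) k

/-- The pair of generic matrices. -/
def generic : Matrix (Fin n) (Fin n) (MatRing n k) × Matrix (Fin n) (Fin n) (MatRing n k) :=
  (Matrix.of fun i j => MvPolynomial.X (Sum.inl (i, j)),
    Matrix.of fun i j => MvPolynomial.X (Sum.inr (i, j)))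

variable {n k} in
/-- Evaluation of functions on `gl_n ⊕ gl_n` at a pair of matrices. -/
def evalAt {B : Type u} [CommRing B] [Algebra k B]
    (P : Matrix (Fin n) (Fin n) B × Matrix (Fin n) (Fin n) B) : MatRing n k →ₐ[k] B :=
  MvPolynomial.aeval (Sum.elim (fun p => P.1 p.1 p.2) fun p => P.2 p.1 p.2)

/-- The action of the torus on functions on `gl_n ⊕ gl_n`:
`(t • f)(X, Y) = f (t⁻¹ • (X, Y))`. -/
def matAction : Torus n k →* (MatRing n k →ₐ[k] MatRing n k) where
  toFun t := evalAt (matAct t⁻¹ (generic n k))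
  map_one' := by
    refine MvPolynomial.algHom_ext fun p => ?_
    rcases p with ⟨i, j⟩ | ⟨i, j⟩ <;>
      simp [evalAt, matAct_fst, matAct_snd, generic]
  map_mul' s t := by
    refine MvPolynomial.algHom_ext fun p => ?_
    rcases p with ⟨i, j⟩ | ⟨i, j⟩ <;>
    · simp only [evalAt, matAct_fst, matAct_snd, generic, MvPolynomial.aeval_X, Sum.elim_inl,
        Sum.elim_inr, AlgHom.mul_apply, map_mul, AlgHom.commutes,
        Matrix.of_apply, Prod.fst_inv, Prod.snd_inv, Pi.inv_apply, Prod.fst_mul, Prod.snd_mul,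
        Pi.mul_apply, mul_inv_rev, Units.val_mul, inv_inv]
      ring

theorem evalAt_matAction {B : Type u} [CommRing B] [Algebra k B] (t : Torus n k)
    (P : Matrix (Fin n) (Fin n) B × Matrix (Fin n) (Fin n) B) (f : MatRing n k) :
    evalAt P (matAction n k t f) = evalAt (matAct t⁻¹ P) f := by
  have : (evalAt P).comp (matAction n k t) = evalAt (k := k) (matAct t⁻¹ P) := by
    refine MvPolynomial.algHom_ext fun p => ?_
    rcases p with ⟨i, j⟩ | ⟨i, j⟩ <;>
      simp only [matAction, evalAt, matAct_fst, matAct_snd, generic, MvPolynomial.aeval_X,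
        Sum.elim_inl, Sum.elim_inr, AlgHom.comp_apply, MonoidHom.coe_mk, OneHom.coe_mk,
        map_mul, AlgHom.commutes, Matrix.of_apply]
  exact DFunLike.congr_fun this f

/-- The ideal of the commuting variety: it is generated by the entries of `XY - YX`. -/
def commIdeal : Ideal (MatRing n k) :=
  Ideal.span (Set.range fun p : Fin n × Fin n =>
    ((generic n k).1 * (generic n k).2 - (generic n k).2 * (generic n k).1) p.1 p.2)

/-- The coordinate ring of `Comm_n = {(X, Y) | XY = YX}`. -/
abbrev CommutingRing : Type u := MatRing n k ⧸ commIdeal n k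

theorem commIdeal_le (t : Torus n k) :
    commIdeal n k ≤ (commIdeal n k).comap (matAction n k t) := by
  rw [commIdeal, Ideal.span_le]
  rintro _ ⟨⟨i, j⟩, rfl⟩
  have hX (a b : Fin n) := matAct_fst t⁻¹ (generic n k) a b
  have hY (a b : Fin n) := matAct_snd t⁻¹ (generic n k) a b
  have key : matAction n k t (((generic n k).1 * (generic n k).2 -
      (generic n k).2 * (generic n k).1) i j) =
      algebraMap k _ ((t.2.1⁻¹ : kˣ) * (t.2.2⁻¹ : kˣ) * ((t.1 i)⁻¹ : kˣ) * t.1 j) *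
      ((generic n k).1 * (generic n k).2 - (generic n k).2 * (generic n k).1) i j := by
    have hX' (a b : Fin n) : matAction n k t ((generic n k).1 a b) =
        (matAct t⁻¹ (generic n k)).1 a b := by simp [matAction, evalAt, generic]
    have hY' (a b : Fin n) : matAction n k t ((generic n k).2 a b) =
        (matAct t⁻¹ (generic n k)).2 a b := by simp [matAction, evalAt, generic]
    simp only [Matrix.sub_apply, Matrix.mul_apply, map_sub, map_sum, hX', hY', mul_sub,
      Finset.mul_sum, map_mul (matAction n k t)]
    have hl (l : Fin n) : algebraMap k (MatRing n k) (t.1 l) *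
        algebraMap k (MatRing n k) ↑(t.1 l)⁻¹ = 1 := by
      rw [← map_mul, Units.mul_inv, map_one]
    congr 1 <;> refine Finset.sum_congr rfl fun l _ => ?_
    all_goals
      simp only [hX, hY, map_mul, Prod.fst_inv, Prod.snd_inv, Pi.inv_apply, inv_inv]
    · linear_combination (algebraMap k (MatRing n k) ↑t.2.1⁻¹ *
        algebraMap k (MatRing n k) ↑t.2.2⁻¹ * algebraMap k (MatRing n k) ↑(t.1 i)⁻¹ *
        algebraMap k (MatRing n k) ↑(t.1 j) * (generic n k).1 i l * (generic n k).2 l j) * hl l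
    · linear_combination (algebraMap k (MatRing n k) ↑t.2.1⁻¹ *
        algebraMap k (MatRing n k) ↑t.2.2⁻¹ * algebraMap k (MatRing n k) ↑(t.1 i)⁻¹ *
        algebraMap k (MatRing n k) ↑(t.1 j) * (generic n k).2 i l * (generic n k).1 l j) * hl l
  change matAction n k t _ ∈ commIdeal n k
  rw [key]
  exact Ideal.mul_mem_left _ _ (Ideal.subset_span ⟨(i, j), rfl⟩)

/-- The action of the torus on functions on `Comm_n`. -/
def commAction : Torus n k →* (CommutingRing n k →ₐ[k] CommutingRing n k) where
  toFun t := Ideal.quotientMapₐ _ (matAction n k t) (commIdeal_le n k t)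
  map_one' := by
    refine AlgHom.ext fun x => ?_
    obtain ⟨x, rfl⟩ := Ideal.Quotient.mk_surjective x
    change Ideal.Quotient.mk _ (matAction n k 1 x) = Ideal.Quotient.mk _ x
    rw [map_one]; rfl
  map_mul' s t := by
    refine AlgHom.ext fun x => ?_
    obtain ⟨x, rfl⟩ := Ideal.Quotient.mk_surjective x
    change Ideal.Quotient.mk _ (matAction n k (s * t) x) =
      Ideal.Quotient.mk _ (matAction n k s (matAction n k t x))
    rw [map_mul]; rfl

/-- The Grothendieck group of equivariant coherent sheaves on `gl_n ⊕ gl_n`. -/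
abbrev KMat : Type (u + 1) := KGroup (matAction n k)

/-- The Grothendieck group of equivariant coherent sheaves on `Comm_n`. -/
abbrev KComm : Type (u + 1) := KGroup (commAction n k)

/-- The pushforward `p_*` along the inclusion `p : Comm_n ⊆ gl_n ⊕ gl_n`. -/
def pPush : KComm n k →+ KMat n k :=
  pushforward (Ideal.Quotient.mkₐ k (commIdeal n k)) (Ideal.Quotient.mkₐ_surjective k _)
    fun _ _ => rfl

/-- Evaluation of functions on `gl_n ⊕ gl_n` at the origin. -/
def evalZero : MatRing n k →ₐ[k] k := evalAt (0, 0)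

theorem evalZero_matAction (t : Torus n k) (f : MatRing n k) :
    evalZero n k (matAction n k t f) = evalZero n k f := by
  rw [evalZero, evalAt_matAction]
  congr 1
  simp [matAct]

variable {n k} in
/-- The homomorphism `r` is the pullback `r₀^*` along the inclusion `r₀` of the origin into
`gl_n ⊕ gl_n`: `r [F] = ∑_i (-1)^i [Tor_i(𝒪_0, F)]` for all equivariant coherent sheaves `F`.
(There is at most one such homomorphism, as the classes `[F]` generate the Grothendieck group.) -/
def IsPullbackToOrigin (r : KMat n k →+ RepRing n) : Prop :=
  ∀ F : EqCoh (matAction n k),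
    r (KGroup.cls F) = F.toEqModule.torClass (evalZero_matAction n k)

end Commuting
end WheelCondition
end

/-! Write A for the coordinate ring of pairs of matrices, and w_s for the character by which the
torus acts on the coordinate X_s. Each X_s has total degree -1 in the exponents of q₁ and q₂, so A
has finite-dimensional weight spaces, and a finitely generated equivariant module M has a Hilbert
function h_M on the weight lattice. Laurent polynomials act on such functions by convolution.

The key formula is that the alternating sum of the classes of Tor_i(k, M) is ∏_s (1 - w_s) · h_M
(`EqModule.coeff_torClass_matAction`). It is proved by killing the coordinates one at a time in the
canonical resolution: they form a regular sequence on its free terms, and each new coordinate gives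
a long exact sequence whose Euler characteristic is multiplied by 1 - w_s
(`EqComplex.euler_varIdeal`). The terms of the resolution need not be finitely generated, so
everything is phrased for subquotients Q ⧸ P with Q finitely generated over P. Additivity of h_M in
short exact sequences then makes r₀^* well defined.

For the wheel condition, suppose a commutator entry c kills M, and that c becomes X_s X_{s'} when
all coordinates other than X_s and X_{s'} are set to zero. For any coordinate v, the factor 1 - w_v
replaces the Hilbert function of Q ⧸ P by a combination of those of the kernel and cokernel of X_v,
both killed by X_v. After this has been done for all v other than s and s', the product X_s X_{s'}
acts as zero. Such a subquotient is an extension of one killed by X_s by one killed by X_{s'}. On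
the former, 1 - w_{s'} already yields a Laurent polynomial, on the latter 1 - w_s does; the unused
factor puts the result in the ideal (1 - w_s, 1 - w_{s'}) (`EqModule.koszul_hilb_mem`). For s = (i,
j) and s' = (j, l), one coordinate of X and one of Y, these factors are unit multiples of the
generators in the theorem. -/

noncomputable section

namespace WheelCondition

universe u

/-! ### Relative finiteness and relative dimension of submodules -/

section Relative

/-- `Q` is generated by `P` and finitely many elements. -/
def FGOver {R M : Type*} [Ring R] [AddCommGroup M] [Module R M] (P Q : Submodule R M) : Prop :=
  ∃ S : Submodule R M, S.FG ∧ P ⊔ S = Q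

section Ring

variable {R M M' : Type*} [Ring R] [AddCommGroup M] [Module R M] [AddCommGroup M'] [Module R M']
  {P Q Q₁ : Submodule R M}

theorem FGOver.refl (P : Submodule R M) : FGOver P P := ⟨⊥, Submodule.fg_bot, by simp⟩

theorem FGOver.trans (h₁ : FGOver P Q₁) (h₂ : FGOver Q₁ Q) : FGOver P Q := by
  obtain ⟨S, hS, rfl⟩ := h₁
  obtain ⟨S', hS', rfl⟩ := h₂
  exact ⟨S ⊔ S', hS.sup hS', by rw [sup_assoc]⟩

theorem FGOver.of_le (h : FGOver P Q) (h₁ : P ≤ Q₁) (h₂ : Q₁ ≤ Q) : FGOver Q₁ Q := by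
  obtain ⟨S, hS, rfl⟩ := h
  refine ⟨S, hS, le_antisymm (sup_le h₂ le_sup_right) (sup_le_sup_right h₁ _)⟩

/-- By the modular law, `S ⊓ Q₁` generates `Q₁` over `P`, and it is finitely generated because `S`
is Noetherian. -/
theorem FGOver.restrict [IsNoetherianRing R] (h : FGOver P Q) (h₁ : P ≤ Q₁) (h₂ : Q₁ ≤ Q) :
    FGOver P Q₁ := by
  obtain ⟨S, hS, rfl⟩ := h
  have := isNoetherian_of_fg_of_noetherian S hS
  refine ⟨S ⊓ Q₁, ?_, ?_⟩
  · have := (IsNoetherian.noetherian (Submodule.comap S.subtype Q₁)).map S.subtype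
    rwa [Submodule.map_comap_subtype] at this
  · rw [← sup_inf_assoc_of_le _ h₁]
    exact inf_eq_right.2 h₂

/-- The hypotheses say that `g` induces a surjection from Q ⧸ P onto Q' ⧸ P'. -/
theorem FGOver.map_sup (h : FGOver P Q) (g : M →ₗ[R] M') {P' Q' : Submodule R M'}
    (hg : Q.map g ⊔ P' = Q') (hP : P ≤ P'.comap g) : FGOver P' Q' := by
  obtain ⟨S, hS, rfl⟩ := h
  refine ⟨S.map g, hS.map g, ?_⟩
  rw [← hg, Submodule.map_sup, sup_comm P', sup_assoc, sup_comm (Submodule.map g P), sup_assoc,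
    sup_eq_left.2 (Submodule.map_le_iff_le_comap.2 hP)]

/-- The two equations say exactly that `g` induces an isomorphism from Q ⧸ P to Q' ⧸ P'; generators
are lifted along it. This encoding of an isomorphism of subquotients recurs throughout. -/
theorem FGOver.of_map_sup {g : M →ₗ[R] M'} {P' Q' : Submodule R M'} (h : FGOver P' Q')
    (hg : Q.map g ⊔ P' = Q') (hP : Q ⊓ P'.comap g = P) : FGOver P Q := by
  classical
  obtain ⟨S, ⟨s, rfl⟩, hS⟩ := h
  have hs : ∀ y ∈ s, ∃ q ∈ Q, y - g q ∈ P' := by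
    intro y hy
    have : y ∈ Q.map g ⊔ P' := by
      rw [hg, ← hS]
      exact Submodule.mem_sup_right (Submodule.subset_span hy)
    obtain ⟨_, ⟨q, hq, rfl⟩, p, hp, rfl⟩ := Submodule.mem_sup.1 this
    exact ⟨q, hq, by simpa using hp⟩
  choose! q hq hqs using hs
  refine ⟨Submodule.span R (s.image q : Finset M), ⟨_, rfl⟩, le_antisymm (sup_le ?_ ?_) ?_⟩
  · exact hP ▸ inf_le_left
  · rw [Submodule.span_le]
    intro x hx
    obtain ⟨y, hy, rfl⟩ := Finset.mem_image.1 hx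
    exact hq y hy
  · intro x hx
    have h1 : ∀ y ∈ Submodule.span R (s : Set M'),
        ∃ z ∈ Submodule.span R (s.image q : Finset M), z ∈ Q ∧ y - g z ∈ P' := by
      intro y hy
      induction hy using Submodule.span_induction with
      | mem y hy =>
        exact ⟨q y, Submodule.subset_span (Finset.mem_image_of_mem q hy), hq y hy, hqs y hy⟩
      | zero => exact ⟨0, zero_mem _, zero_mem _, by simp⟩
      | add a b _ _ ha hb =>
        obtain ⟨z, h1, h2, h3⟩ := ha
        obtain ⟨z', h1', h2', h3'⟩ := hb
        exact ⟨z + z', add_mem h1 h1', add_mem h2 h2', by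
          rw [map_add, add_sub_add_comm]; exact add_mem h3 h3'⟩
      | smul r a _ ha =>
        obtain ⟨z, h1, h2, h3⟩ := ha
        exact ⟨r • z, Submodule.smul_mem _ _ h1, Submodule.smul_mem _ _ h2, by
          rw [map_smul, ← smul_sub]; exact Submodule.smul_mem _ _ h3⟩
    have hx' : g x ∈ P' ⊔ Submodule.span R (s : Set M') := by
      rw [hS, ← hg]
      exact Submodule.mem_sup_left ⟨x, hx, rfl⟩
    obtain ⟨p, hp, y, hy, hpy⟩ := Submodule.mem_sup.1 hx'
    obtain ⟨z, h2, h3, h4⟩ := h1 y hy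
    refine Submodule.mem_sup.2 ⟨x - z, hP ▸ ⟨sub_mem hx h3, ?_⟩, z, h2, by abel⟩
    change g (x - z) ∈ P'
    rw [map_sub, ← hpy, add_sub_assoc]
    exact add_mem hp h4

end Ring

/-! ### Relative dimension over a field. -/

section Field

variable {k V V' : Type*} [Field k] [AddCommGroup V] [Module k V] [AddCommGroup V'] [Module k V']

/-- The dimension of `Q ⧸ P`, for subspaces `P ≤ Q`. -/
def relDim (P Q : Submodule k V) : ℕ := Module.finrank k (Q.map P.mkQ)

variable {P Q R : Submodule k V}

theorem FGOver.finite (h : FGOver P Q) : Module.Finite k (Q.map P.mkQ) := by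
  obtain ⟨S, hS, rfl⟩ := h
  rw [Module.Finite.iff_fg, Submodule.map_sup, Submodule.mkQ_map_self, bot_sup_eq]
  exact hS.map _

theorem relDim_of_le (h : Q ≤ P) : relDim P Q = 0 := by
  have : Q.map P.mkQ = ⊥ := by
    rw [Submodule.eq_bot_iff]
    rintro _ ⟨q, hq, rfl⟩
    exact (Submodule.Quotient.mk_eq_zero P).2 (h hq)
  rw [relDim, this, finrank_bot]

theorem relDim_bot (Q : Submodule k V) : relDim ⊥ Q = Module.finrank k Q := by
  refine (LinearEquiv.finrank_eq (Submodule.equivMapOfInjective _ ?_ Q)).symm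
  rw [← LinearMap.ker_eq_bot, Submodule.ker_mkQ]

theorem relDim_eq (g : V →ₗ[k] V') {P' Q' : Submodule k V'} (hg : Q.map g ⊔ P' = Q')
    (hP : Q ⊓ P'.comap g = P) : relDim P Q = relDim P' Q' := by
  have hle : P ≤ P'.comap g := hP ▸ inf_le_right
  let φ : Q.map P.mkQ →ₗ[k] Q'.map P'.mkQ := (P.mapQ P' g hle).restrict (by
    rintro _ ⟨q, hq, rfl⟩
    exact ⟨g q, by rw [← hg]; exact Submodule.mem_sup_left ⟨q, hq, rfl⟩, rfl⟩)
  refine LinearEquiv.finrank_eq (LinearEquiv.ofBijective φ ⟨?_, ?_⟩)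
  · rw [injective_iff_map_eq_zero]
    rintro ⟨_, q, hq, rfl⟩ h
    have h0 : P'.mkQ (g q) = 0 := congrArg Subtype.val h
    have : q ∈ P := hP ▸ ⟨hq, by simpa using h0⟩
    exact Subtype.ext ((Submodule.Quotient.mk_eq_zero P).2 this)
  · rintro ⟨_, q', hq', rfl⟩
    rw [← hg] at hq'
    obtain ⟨_, ⟨q, hq, rfl⟩, p, hp, rfl⟩ := Submodule.mem_sup.1 hq'
    refine ⟨⟨_, q, hq, rfl⟩, Subtype.ext ?_⟩
    change P'.mkQ (g q) = P'.mkQ (g q + p)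
    rw [map_add, (Submodule.Quotient.mk_eq_zero P').2 hp |> fun h => (h : P'.mkQ p = 0), add_zero]

/-- Rank-nullity for R ⧸ P → R ⧸ Q. Finiteness matters, since `finrank` takes the value 0 on
infinite-dimensional spaces. -/
theorem relDim_add (h₁ : P ≤ Q) (h₂ : Q ≤ R) (h : FGOver P R) :
    relDim P R = relDim P Q + relDim Q R := by
  have := h.finite
  let φ : R.map P.mkQ →ₗ[k] V ⧸ Q := (P.mapQ Q LinearMap.id h₁) ∘ₗ (R.map P.mkQ).subtype
  have hr : LinearMap.range φ = R.map Q.mkQ := by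
    rw [LinearMap.range_comp, Submodule.range_subtype, ← Submodule.map_comp]
    congr 1
  have hk : (LinearMap.ker φ).map (R.map P.mkQ).subtype = Q.map P.mkQ := by
    ext x
    constructor
    · rintro ⟨⟨_, r, hr, rfl⟩, h, rfl⟩
      have h0 : Q.mkQ r = 0 := h
      exact ⟨r, by simpa using h0, rfl⟩
    · rintro ⟨q, hq, rfl⟩
      exact ⟨⟨_, q, h₂ hq, rfl⟩, (Submodule.Quotient.mk_eq_zero Q).2 hq, rfl⟩
  have h1 := LinearMap.finrank_range_add_finrank_ker φ
  rw [hr, ← Submodule.finrank_map_subtype_eq, hk] at h1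
  rw [relDim, relDim, relDim, ← h1, add_comm]

end Field

end Relative

/-! ### Weights of rational representations of the torus -/

section Weights

variable {n : ℕ} {k : Type u} [Field k]

/-- The character of the torus with exponents `χ`, as a function with values in `k`. -/
def Weight.evalHom (χ : Weight n) : Torus n k →* k where
  toFun t := χ.eval t
  map_one' := by simp [Weight.eval]
  map_mul' s t := by
    simp only [Weight.eval, Prod.fst_mul, Prod.snd_mul, Pi.mul_apply, mul_zpow,
      Finset.prod_mul_distrib, Units.val_mul]
    ring

theorem Weight.eval_mul (χ : Weight n) (s t : Torus n k) :
    (χ.eval (s * t) : k) = χ.eval s * χ.eval t := χ.evalHom.map_mul s t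

theorem Weight.eval_one (χ : Weight n) : (χ.eval (1 : Torus n k) : k) = 1 := χ.evalHom.map_one

theorem Weight.eval_add (χ ψ : Weight n) (t : Torus n k) :
    (χ + ψ).eval t = χ.eval t * ψ.eval t := by
  simp only [Weight.eval, Prod.fst_add, Prod.snd_add, Pi.add_apply, zpow_add,
    Finset.prod_mul_distrib]
  simp only [mul_assoc, mul_left_comm, mul_comm]

theorem Weight.eval_neg (χ : Weight n) (t : Torus n k) : (-χ).eval t = (χ.eval t)⁻¹ := by
  rw [eq_inv_iff_mul_eq_one, ← Weight.eval_add, neg_add_cancel]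
  simp [Weight.eval]

/-- The polynomial T^|m| - 1 has only finitely many roots. -/
theorem exists_zpow_ne_one (k : Type u) [Field k] [Infinite k] {m : ℤ} (hm : m ≠ 0) :
    ∃ a : kˣ, a ^ m ≠ 1 := by
  classical
  by_contra! h
  have h' : ∀ a : kˣ, a ^ m.natAbs = 1 := fun a => by
    rcases Int.natAbs_eq m with e | e
    · rw [← zpow_natCast, ← e]; exact h a
    · have := h a
      rw [e, zpow_neg, inv_eq_one] at this
      rwa [← zpow_natCast]
  have : NeZero m.natAbs := ⟨Int.natAbs_ne_zero.2 hm⟩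
  have hu : (Set.univ : Set k).Finite := by
    refine ((Set.finite_singleton (0 : k)).union
      ((Polynomial.nthRoots m.natAbs (1 : k)).toFinset.finite_toSet)).subset fun a _ => ?_
    by_cases ha : a = 0
    · exact Or.inl ha
    · right
      have h1 := congrArg Units.val (h' (Units.mk0 a ha))
      simp only [Finset.mem_coe, Multiset.mem_toFinset]
      rw [Polynomial.mem_nthRoots (Nat.pos_of_ne_zero (NeZero.ne _))]
      simpa using h1
  exact Set.infinite_univ hu

variable [Infinite k]

/-- Evaluate the difference of two weights on the coordinate one-parameter subgroups, one for each
exponent. -/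
theorem Weight.evalHom_injective :
    Function.Injective (Weight.evalHom : Weight n → Torus n k →* k) := by
  intro χ ψ h
  have key : ∀ t : Torus n k, (χ - ψ).eval t = 1 := fun t => by
    have : (χ.eval t : k) = ψ.eval t := DFunLike.congr_fun h t
    rw [sub_eq_add_neg, Weight.eval_add, Weight.eval_neg, Units.ext this, mul_inv_cancel]
  rw [← sub_eq_zero]
  set ω := χ - ψ
  refine Prod.ext (funext fun i => ?_) (Prod.ext ?_ ?_)
  · by_contra hm
    obtain ⟨a, ha⟩ := exists_zpow_ne_one k hm
    refine ha ?_
    have := key (Pi.mulSingle i a, 1, 1)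
    rw [Weight.eval, Finset.prod_eq_single i] at this
    · simpa using this
    · intro j _ hj
      change (Pi.mulSingle i a : Fin n → kˣ) j ^ ω.1 j = 1
      rw [Pi.mulSingle_eq_of_ne hj, one_zpow]
    · simp
  · by_contra hm
    obtain ⟨a, ha⟩ := exists_zpow_ne_one k hm
    exact ha (by simpa [Weight.eval] using key (1, a, 1))
  · by_contra hm
    obtain ⟨a, ha⟩ := exists_zpow_ne_one k hm
    exact ha (by simpa [Weight.eval] using key (1, 1, a))

variable {V V' : Type u} [AddCommGroup V] [Module k V] [AddCommGroup V'] [Module k V']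

/-- Characters are linearly independent, with coefficients in any vector space. -/
theorem eq_zero_of_sum_eval_smul_eq_zero (c : Weight n →₀ V)
    (h : ∀ t : Torus n k, (c.sum fun χ v => (χ.eval t : k) • v) = 0) : c = 0 := by
  -- Applying a linear functional to the coefficients reduces the claim to Dedekind's independence
  -- of distinct characters over `k`.
  have hli := (linearIndependent_monoidHom (Torus n k) k).comp _ Weight.evalHom_injective
  ext χ
  rw [Finsupp.zero_apply, ← Module.forall_dual_apply_eq_zero_iff k]
  intro φ
  have h0 := (linearIndependent_iff'.1 hli) c.support (fun ψ => φ (c ψ)) (by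
    ext t
    have := congrArg φ (h t)
    rw [Finsupp.sum, map_sum, map_zero] at this
    simpa [Finset.sum_apply, Weight.evalHom, mul_comm] using this)
  by_cases hχ : χ ∈ c.support
  · exact h0 χ hχ
  · rw [Finsupp.notMem_support_iff.1 hχ, map_zero]

/-- A representation of the torus which is the sum of its weight spaces. -/
def IsRational (ρ : Representation k (Torus n k) V) : Prop := ⨆ χ, weightSpace ρ χ = ⊤

/-- A set which is stable under the torus. -/
def IsStable (ρ : Representation k (Torus n k) V) (S : Set V) : Prop :=
  ∀ t, ∀ v ∈ S, ρ t v ∈ S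

/-- A linear map which is equivariant up to the character `w`. -/
def IsShift (ρ : Representation k (Torus n k) V) (ρ' : Representation k (Torus n k) V')
    (w : Weight n) (g : V →ₗ[k] V') : Prop :=
  ∀ t v, ρ' t (g v) = (w.eval t : k) • g (ρ t v)

variable {ρ : Representation k (Torus n k) V} {ρ' : Representation k (Torus n k) V'}
  {w : Weight n} {g : V →ₗ[k] V'}

omit [Infinite k] in
theorem isShift_zero (h : ∀ t v, g (ρ t v) = ρ' t (g v)) : IsShift ρ ρ' 0 g := fun t v => by
  simp [h, Weight.eval]

omit [Infinite k] in
theorem IsShift.mem_weightSpace (hg : IsShift ρ ρ' w g) {χ : Weight n} {v : V}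
    (hv : v ∈ weightSpace ρ χ) : g v ∈ weightSpace ρ' (χ + w) := fun t => by
  rw [hg, hv t, map_smul, smul_smul, Weight.eval_add, Units.val_mul, mul_comm]

omit [Infinite k] in
theorem IsRational.exists_sum (h : IsRational ρ) (v : V) :
    ∃ c : Weight n →₀ V, (∀ χ, c χ ∈ weightSpace ρ χ) ∧ (c.sum fun _ v => v) = v :=
  (Submodule.mem_iSup_iff_exists_finsupp _ _).1 (h ▸ Submodule.mem_top : v ∈ ⨆ χ, weightSpace ρ χ)

omit [Infinite k] in
theorem isRational_of_exists_sum (h : ∀ v : V,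
    ∃ c : Weight n →₀ V, (∀ χ, c χ ∈ weightSpace ρ χ) ∧ (c.sum fun _ v => v) = v) :
    IsRational ρ :=
  eq_top_iff.2 fun v _ => (Submodule.mem_iSup_iff_exists_finsupp _ _).2 (h v)

/-- A stable subspace contains the weight components of its elements. -/
theorem IsStable.component_mem {S : Submodule k V} (hS : IsStable ρ (S : Set V))
    {c : Weight n →₀ V} (hc : ∀ χ, c χ ∈ weightSpace ρ χ) (h : (c.sum fun _ v => v) ∈ S)
    (χ : Weight n) : c χ ∈ S := by
  -- Modulo `S` all translates of the vector vanish; independence of characters then kills each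
  -- component modulo `S`.
  have h0 : c.mapRange S.mkQ (map_zero _) = 0 := by
    refine eq_zero_of_sum_eval_smul_eq_zero (k := k) _ fun t => ?_
    rw [Finsupp.sum_mapRange_index (by simp)]
    have h1 : S.mkQ (ρ t (c.sum fun _ v => v)) = 0 :=
      (Submodule.Quotient.mk_eq_zero S).2 (hS t _ h)
    rw [Finsupp.sum, map_sum, map_sum] at h1
    rw [Finsupp.sum, ← h1]
    refine Finset.sum_congr rfl fun χ _ => ?_
    rw [hc χ t, map_smul]
  have := DFunLike.congr_fun h0 χ
  rw [Finsupp.mapRange_apply, Finsupp.zero_apply] at this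
  exact (Submodule.Quotient.mk_eq_zero S).1 this

/-- Expanding ρ(st)v = ρ(s)ρ(t)v in characters of t and comparing coefficients shows that each
coefficient of an orbit map is a weight vector. At t = 1 these coefficients sum to v. -/
theorem isRational_of_algebraic (h : ∀ v : V, ∃ c : Weight n →₀ V,
    ∀ t, ρ t v = c.sum fun χ v => (χ.eval t : k) • v) : IsRational ρ := by
  refine isRational_of_exists_sum fun v => ?_
  obtain ⟨c, hc⟩ := h v
  refine ⟨c, fun χ s => ?_, ?_⟩
  · let φ : Weight n → V →ₗ[k] V := fun χ => (χ.eval s : k) • LinearMap.id - ρ s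
    let c' : Weight n →₀ V := Finsupp.onFinset c.support (fun χ => φ χ (c χ)) fun χ hχ => by
      rw [Finsupp.mem_support_iff]
      rintro h0
      exact hχ (by rw [h0, map_zero])
    have h0 : c' = 0 := by
      refine eq_zero_of_sum_eval_smul_eq_zero (k := k) _ fun t => ?_
      rw [Finsupp.onFinset_sum _ (by simp)]
      have h1 : ρ (s * t) v = ρ s (ρ t v) := by rw [map_mul]; rfl
      rw [hc, hc t, Finsupp.sum, Finsupp.sum, map_sum, ← sub_eq_zero,
        ← Finset.sum_sub_distrib] at h1
      rw [← h1]
      refine Finset.sum_congr rfl fun χ _ => ?_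
      simp only [φ, LinearMap.sub_apply, LinearMap.smul_apply, LinearMap.id_apply, smul_sub,
        map_smul, smul_smul, Weight.eval_mul, mul_comm]
    have := DFunLike.congr_fun h0 χ
    simp only [c', φ, Finsupp.onFinset_apply, Finsupp.zero_apply, LinearMap.sub_apply,
      LinearMap.smul_apply, LinearMap.id_apply] at this
    exact (sub_eq_zero.1 this).symm
  · have := hc 1
    rw [map_one, Module.End.one_apply] at this
    rw [this]
    simp [Weight.eval_one]

omit [Infinite k] in
theorem IsRational.of_surjective (h : IsRational ρ) (hg : IsShift ρ ρ' 0 g)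
    (hs : Function.Surjective g) : IsRational ρ' := by
  rw [IsRational, eq_top_iff, ← LinearMap.range_eq_top.2 hs, ← Submodule.map_top, ← h,
    Submodule.map_iSup]
  refine iSup_mono fun χ => Submodule.map_le_iff_le_comap.2 fun v hv => ?_
  simpa using hg.mem_weightSpace hv

theorem IsRational.of_injective (h : IsRational ρ') (hg : IsShift ρ ρ' 0 g)
    (hi : Function.Injective g) : IsRational ρ := by
  refine isRational_of_exists_sum fun v => ?_
  obtain ⟨c, hc, hv⟩ := h.exists_sum (g v)
  -- The range is stable, so the weight components of `g v` lie in it and lift to weight vectors by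
  -- injectivity.
  have hst : IsStable ρ' (LinearMap.range g : Set V') := by
    rintro t _ ⟨v, rfl⟩
    exact ⟨(Weight.eval 0 t : k) • ρ t v, by rw [hg, map_smul]⟩
  have hm : ∀ χ, c χ ∈ LinearMap.range g := hst.component_mem hc (hv ▸ ⟨v, rfl⟩)
  choose b hb using hm
  have hb0 : ∀ χ, b χ ≠ 0 → χ ∈ c.support := fun χ hχ => by
    rw [Finsupp.mem_support_iff, ← hb]
    exact fun h0 => hχ (hi (by rw [h0, map_zero]))
  refine ⟨Finsupp.onFinset c.support b hb0, fun χ t => hi ?_, hi ?_⟩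
  · have h1 := hg t (b χ)
    have h2 := hc χ t
    rw [← hb] at h2
    rw [Finsupp.onFinset_apply, map_smul, ← h2, h1]
    simp [Weight.eval]
  · rw [Finsupp.onFinset_sum _ (by simp), map_sum, ← hv]
    exact Finset.sum_congr rfl fun χ _ => hb χ

omit [Infinite k] in
theorem IsRational.tprod (h : IsRational ρ) (h' : IsRational ρ') : IsRational (ρ.tprod ρ') := by
  rw [IsRational, eq_top_iff, ← TensorProduct.span_tmul_eq_top, Submodule.span_le]
  rintro _ ⟨v, v', rfl⟩
  obtain ⟨c, hc, rfl⟩ := h.exists_sum v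
  obtain ⟨c', hc', rfl⟩ := h'.exists_sum v'
  rw [Finsupp.sum, Finsupp.sum, TensorProduct.sum_tmul]
  refine sum_mem fun χ _ => ?_
  rw [TensorProduct.tmul_sum]
  refine sum_mem fun ψ _ => Submodule.mem_iSup_of_mem (χ + ψ) fun t => ?_
  rw [Representation.tprod_apply, TensorProduct.map_tmul, hc χ t, hc' ψ t,
    TensorProduct.smul_tmul_smul, Weight.eval_add, Units.val_mul]

/-- The weight `χ` part of a subspace. -/
def wtPart (ρ : Representation k (Torus n k) V) (S : Submodule k V) (χ : Weight n) :
    Submodule k V := S ⊓ weightSpace ρ χ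

/-- Taking the weight part is exact on rational representations: an equation between stable
submodules may be checked weight by weight. -/
theorem map_wtPart_sup (hV : IsRational ρ) (hg : IsShift ρ ρ' w g) {Q : Submodule k V}
    {P' Q' : Submodule k V'} (hQ : IsStable ρ (Q : Set V)) (hP' : IsStable ρ' (P' : Set V'))
    (h : Q.map g ⊔ P' = Q') (χ : Weight n) :
    (wtPart ρ Q χ).map g ⊔ wtPart ρ' P' (χ + w) = wtPart ρ' Q' (χ + w) := by
  refine le_antisymm (sup_le ?_ ?_) ?_
  · rintro _ ⟨q, hq, rfl⟩
    exact ⟨h ▸ Submodule.mem_sup_left ⟨q, hq.1, rfl⟩, hg.mem_weightSpace hq.2⟩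
  · exact inf_le_inf_right _ (h ▸ le_sup_right)
  · rintro y ⟨hy, hyw⟩
    obtain ⟨_, ⟨q, hq, rfl⟩, p, hp, hpy⟩ := Submodule.mem_sup.1 (h ▸ hy : y ∈ Q.map g ⊔ P')
    obtain ⟨c, hc, rfl⟩ := hV.exists_sum q
    have hcQ := hQ.component_mem hc hq
    -- This is the weight decomposition of `p = y - g q`; its component of weight `χ + w` is y minus
    -- the image of the component of q of weight `χ`.
    let c' : Weight n →₀ V' := Finsupp.single (χ + w) y -
      (c.mapRange g (map_zero g)).embDomain (addRightEmbedding w)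
    have hc'a : ∀ ψ, c' (ψ + w) = (if ψ = χ then y else 0) - g (c ψ) := fun ψ => by
      have := Finsupp.embDomain_apply_self (addRightEmbedding w) (c.mapRange g (map_zero g)) ψ
      rw [addRightEmbedding_apply] at this
      simp only [c', Finsupp.sub_apply, this, Finsupp.mapRange_apply, Finsupp.single_apply,
        add_left_inj, eq_comm]
    have hc' : ∀ ψ, c' ψ ∈ weightSpace ρ' ψ := fun ψ => by
      obtain ⟨ψ, rfl⟩ : ∃ ψ₀, ψ = ψ₀ + w := ⟨ψ - w, by simp⟩
      rw [hc'a]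
      refine sub_mem ?_ (hg.mem_weightSpace (hc ψ))
      split_ifs with he
      · rwa [he]
      · exact zero_mem _
    have hsum : (c'.sum fun _ v => v) = p := by
      rw [Finsupp.sum_sub_index (by simp), Finsupp.sum_single_index rfl, Finsupp.sum_embDomain,
        Finsupp.sum_mapRange_index (by simp), ← hpy, Finsupp.sum, Finsupp.sum, map_sum]
      abel
    have hp' := hP'.component_mem hc' (hsum ▸ hp) (χ + w)
    have hw' := hc' (χ + w)
    rw [hc'a, if_pos rfl] at hp' hw'
    exact Submodule.mem_sup.2 ⟨_, ⟨_, ⟨hcQ χ, hc χ⟩, rfl⟩, _, ⟨hp', hw'⟩, by abel⟩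

omit [Infinite k] in
theorem wtPart_inf_comap (hg : IsShift ρ ρ' w g) {P Q : Submodule k V} {P' : Submodule k V'}
    (h : Q ⊓ P'.comap g = P) (χ : Weight n) :
    wtPart ρ Q χ ⊓ (wtPart ρ' P' (χ + w)).comap g = wtPart ρ P χ := by
  subst h
  ext v
  constructor
  · rintro ⟨⟨h1, h2⟩, h3, -⟩
    exact ⟨⟨h1, h3⟩, h2⟩
  · rintro ⟨⟨h1, h3⟩, h2⟩
    exact ⟨⟨h1, h2⟩, h3, hg.mem_weightSpace h2⟩

theorem relDim_wtPart_eq (hV : IsRational ρ) (hg : IsShift ρ ρ' w g) {P Q : Submodule k V}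
    {P' Q' : Submodule k V'} (hQ : IsStable ρ (Q : Set V)) (hP' : IsStable ρ' (P' : Set V'))
    (h : Q.map g ⊔ P' = Q') (h' : Q ⊓ P'.comap g = P) (χ : Weight n) :
    relDim (wtPart ρ P χ) (wtPart ρ Q χ) =
      relDim (wtPart ρ' P' (χ + w)) (wtPart ρ' Q' (χ + w)) :=
  relDim_eq g (map_wtPart_sup hV hg hQ hP' h χ) (wtPart_inf_comap hg h' χ)

end Weights

/-! ### Hilbert functions of subquotients of equivariant modules -/

section Hilbert

variable {n : ℕ} {k : Type u} [Field k] {A : Type u} [CommRing A] [Algebra k A]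
  {α : Torus n k →* (A →ₐ[k] A)}

/-- Translation by a weight, as an operator on functions on the weight lattice. -/
def shift (w : Weight n) : Module.End ℤ (Weight n → ℤ) := LinearMap.funLeft ℤ ℤ fun χ => χ - w

@[simp]
theorem shift_apply (w : Weight n) (f : Weight n → ℤ) (χ : Weight n) :
    shift w f χ = f (χ - w) := rfl

namespace EqModule

/-- The Hilbert function `χ ↦ dim (Q ⧸ P)_χ` of a subquotient of an equivariant module. -/
def hilb (N : EqModule α) (P Q : Submodule A N.carrier) : Weight n → ℤ := fun χ =>
  relDim (wtPart N.rho (P.restrictScalars k) χ) (wtPart N.rho (Q.restrictScalars k) χ)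

/-- A submodule which is stable under the torus. -/
abbrev Stable (N : EqModule α) (P : Submodule A N.carrier) : Prop :=
  IsStable N.rho (P : Set N.carrier)

/-- An `A`-linear map which is equivariant up to the character `w`. -/
abbrev Shift (N N' : EqModule α) (w : Weight n) (g : N.carrier →ₗ[A] N'.carrier) : Prop :=
  IsShift N.rho N'.rho w (g.restrictScalars k)

variable {N N' : EqModule α} {P Q R : Submodule A N.carrier} {P' Q' : Submodule A N'.carrier}
  {w : Weight n} {g : N.carrier →ₗ[A] N'.carrier}

theorem stable_top : N.Stable ⊤ := fun _ _ _ => trivial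

theorem stable_bot : N.Stable ⊥ := fun t v hv => by
  rw [SetLike.mem_coe, Submodule.mem_bot] at hv ⊢
  rw [hv, map_zero]

theorem Stable.sup (hP : N.Stable P) (hQ : N.Stable Q) : N.Stable (P ⊔ Q) := fun t v hv => by
  obtain ⟨a, ha, b, hb, rfl⟩ := Submodule.mem_sup.1 hv
  rw [map_add]
  exact Submodule.add_mem_sup (hP t a ha) (hQ t b hb)

theorem Stable.inf (hP : N.Stable P) (hQ : N.Stable Q) : N.Stable (P ⊓ Q) :=
  fun t v hv => ⟨hP t v hv.1, hQ t v hv.2⟩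

theorem Stable.map (hP : N.Stable P) (hg : N.Shift N' w g) : N'.Stable (P.map g) := by
  rintro t _ ⟨v, hv, rfl⟩
  refine ⟨(w.eval t : k) • N.rho t v, (P.restrictScalars k).smul_mem _ (hP t v hv), ?_⟩
  have := hg t v
  rw [← map_smul] at this
  exact this.symm

theorem Stable.comap (hP : N'.Stable P') (hg : N.Shift N' w g) : N.Stable (P'.comap g) := by
  intro t v hv
  have h1 : N'.rho t (g v) ∈ P'.restrictScalars k := hP t _ hv
  have h2 : N'.rho t (g v) = (w.eval t : k) • g (N.rho t v) := hg t v
  rw [h2] at h1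
  exact ((P'.restrictScalars k).smul_mem_iff (Units.ne_zero _)).1 h1

theorem Stable.range (hg : N.Shift N' w g) : N'.Stable (LinearMap.range g) := by
  rw [LinearMap.range_eq_map]
  exact stable_top.map hg

theorem stable_ideal_smul {I : Ideal A} (hI : ∀ t, ∀ a ∈ I, α t a ∈ I) :
    N.Stable (I • (⊤ : Submodule A N.carrier)) := by
  intro t v hv
  refine Submodule.smul_induction_on (p := fun v => N.rho t v ∈ I • (⊤ : Submodule A N.carrier)) hv
    (fun a ha m _ => ?_) fun x y hx hy => ?_
  · rw [N.rho_smul]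
    exact Submodule.smul_mem_smul (hI t a ha) trivial
  · rw [map_add]
    exact add_mem hx hy

theorem shift_lsmul {x : A} (hx : ∀ t, α t x = (w.eval t : k) • x) (N : EqModule α) :
    N.Shift N w (LinearMap.lsmul A N.carrier x) := fun t v => by
  change N.rho t (x • v) = (w.eval t : k) • x • N.rho t v
  rw [N.rho_smul, hx, smul_assoc]

theorem shift_toSpanSingleton {m : N.carrier} (hm : m ∈ weightSpace N.rho w) :
    IsShift (funRep α) N.rho w ((LinearMap.toSpanSingleton A N.carrier m).restrictScalars k) :=
  fun t a => by
    change N.rho t (a • m) = (w.eval t : k) • α t a • m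
    rw [N.rho_smul, hm t, smul_comm]

theorem stable_span_singleton {m : N.carrier} (hm : m ∈ weightSpace N.rho w) :
    N.Stable (Submodule.span A {m}) := by
  intro t v hv
  obtain ⟨a, rfl⟩ := Submodule.mem_span_singleton.1 hv
  rw [N.rho_smul, hm t, smul_comm]
  have h : α t a • m ∈ (Submodule.span A {m}).restrictScalars k :=
    (Submodule.span A {m}).smul_mem _ (Submodule.mem_span_singleton_self m)
  exact Submodule.smul_mem _ _ h

theorem shift_id : N.Shift N 0 LinearMap.id := isShift_zero fun _ _ => rfl

variable [Infinite k]

/-- The conditions `h` and `h'` make `g` an isomorphism of subquotients; since `g` multiplies by the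
character `w`, weights move by `w`. -/
theorem hilb_eq_of_shift (hN : IsRational N.rho) (hg : N.Shift N' w g) (hQ : N.Stable Q)
    (hP' : N'.Stable P') (h : Q.map g ⊔ P' = Q') (h' : Q ⊓ P'.comap g = P) (χ : Weight n) :
    N.hilb P Q χ = N'.hilb P' Q' (χ + w) := by
  refine congrArg Nat.cast (relDim_wtPart_eq hN hg (Q := Q.restrictScalars k)
    (P' := P'.restrictScalars k) hQ hP' ?_ ?_ χ)
  · rw [← h, Submodule.restrictScalars_sup]
    rfl
  · rw [← h']
    rfl

theorem hilb_eq (hN : IsRational N.rho) (hg : N.Shift N' 0 g) (hQ : N.Stable Q)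
    (hP' : N'.Stable P') (h : Q.map g ⊔ P' = Q') (h' : Q ⊓ P'.comap g = P) :
    N.hilb P Q = N'.hilb P' Q' := funext fun χ => by
  rw [hilb_eq_of_shift hN hg hQ hP' h h', add_zero]

omit [Infinite k] in
theorem hilb_of_le (h : Q ≤ P) : N.hilb P Q = 0 := funext fun χ => by
  have h' : Q.restrictScalars k ≤ P.restrictScalars k := h
  exact congrArg Nat.cast (relDim_of_le (inf_le_inf_right (weightSpace N.rho χ) h'))

variable [hA : Fact (IsRational (funRep α))]
  [hfin : ∀ χ, Module.Finite k (weightSpace (funRep α) χ)]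

/-- A cyclic module on a generator of weight `w` is a quotient of `A` with weights shifted by `w`,
and `A` has finite-dimensional weight spaces. -/
theorem fgOver_wtPart_sup_span_singleton (hP : N.Stable P) {m : N.carrier}
    (hm : m ∈ weightSpace N.rho w) (χ : Weight n) :
    FGOver (wtPart N.rho (P.restrictScalars k) χ)
      (wtPart N.rho ((P ⊔ Submodule.span A {m}).restrictScalars k) χ) := by
  have := map_wtPart_sup hA.out (shift_toSpanSingleton hm) (Q := ⊤)
    (P' := P.restrictScalars k) (Q' := (P ⊔ Submodule.span A {m}).restrictScalars k)
    (fun _ _ _ => trivial) hP (by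
      rw [sup_comm, Submodule.restrictScalars_sup, ← LinearMap.range_toSpanSingleton,
        Submodule.map_top]
      rfl) (χ - w)
  rw [sub_add_cancel] at this
  refine ⟨_, Submodule.FG.map _ ?_, (sup_comm _ _).trans this⟩
  rw [wtPart, top_inf_eq]
  exact Module.Finite.iff_fg.1 (hfin _)

theorem fgOver_wtPart_sup_span (hP : N.Stable P) (s : Finset N.carrier)
    (hs : ∀ m ∈ s, ∃ χ, m ∈ weightSpace N.rho χ) (χ : Weight n) :
    N.Stable (P ⊔ Submodule.span A (s : Set N.carrier)) ∧
    FGOver (wtPart N.rho (P.restrictScalars k) χ)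
      (wtPart N.rho ((P ⊔ Submodule.span A (s : Set N.carrier)).restrictScalars k) χ) := by
  classical
  induction s using Finset.induction_on with
  | empty => simpa using ⟨hP, FGOver.refl _⟩
  | insert m s _ ih =>
    obtain ⟨h1, h2⟩ := ih fun m hm => hs m (Finset.mem_insert_of_mem hm)
    obtain ⟨ψ, hψ⟩ := hs m (Finset.mem_insert_self m s)
    rw [Finset.coe_insert, Submodule.span_insert, sup_comm (Submodule.span A {m}), ← sup_assoc]
    exact ⟨h1.sup (stable_span_singleton hψ), h2.trans (fgOver_wtPart_sup_span_singleton h1 hψ χ)⟩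

/-- This makes Hilbert functions of relatively finitely generated subquotients meaningful: their
weight spaces are finite-dimensional. The generators may be replaced by their weight components,
which lie in `Q` by stability. -/
theorem fgOver_wtPart (hN : IsRational N.rho) (hP : N.Stable P) (hQ : N.Stable Q)
    (h : FGOver P Q) (χ : Weight n) :
    FGOver (wtPart N.rho (P.restrictScalars k) χ) (wtPart N.rho (Q.restrictScalars k) χ) := by
  classical
  obtain ⟨_, ⟨s, rfl⟩, hS⟩ := h
  choose c hc hcs using hN.exists_sum
  have hcQ : ∀ m ∈ s, ∀ χ, c m χ ∈ Q := fun m hm =>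
    IsStable.component_mem (S := Q.restrictScalars k) hQ (hc m) (by
      rw [hcs, ← hS]
      exact Submodule.mem_sup_right (Submodule.subset_span hm))
  let s' : Finset N.carrier := s.biUnion fun m => (c m).support.image (c m)
  have hs' : P ⊔ Submodule.span A (s' : Set N.carrier) = Q := by
    refine le_antisymm (sup_le (hS ▸ le_sup_left) ?_) ?_
    · rw [Submodule.span_le]
      intro v hv
      obtain ⟨m, hm, hv⟩ := Finset.mem_biUnion.1 hv
      obtain ⟨χ, -, rfl⟩ := Finset.mem_image.1 hv
      exact hcQ m hm χ
    · rw [← hS]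
      refine sup_le_sup_left ?_ _
      rw [Submodule.span_le]
      intro m hm
      rw [SetLike.mem_coe, ← hcs m]
      exact sum_mem fun χ hχ => Submodule.subset_span
        (Finset.mem_biUnion.2 ⟨m, hm, Finset.mem_image_of_mem _ hχ⟩)
  have := (fgOver_wtPart_sup_span hP s' (fun v hv => by
    obtain ⟨m, -, hv⟩ := Finset.mem_biUnion.1 hv
    obtain ⟨χ, -, rfl⟩ := Finset.mem_image.1 hv
    exact ⟨χ, hc m χ⟩) χ).2
  rwa [hs'] at this

theorem hilb_add (hN : IsRational N.rho) (hP : N.Stable P) (hR : N.Stable R) (h₁ : P ≤ Q)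
    (h₂ : Q ≤ R) (h : FGOver P R) : N.hilb P R = N.hilb P Q + N.hilb Q R := funext fun χ => by
  have h₁' : P.restrictScalars k ≤ Q.restrictScalars k := h₁
  have h₂' : Q.restrictScalars k ≤ R.restrictScalars k := h₂
  have := relDim_add (inf_le_inf_right (weightSpace N.rho χ) h₁')
    (inf_le_inf_right (weightSpace N.rho χ) h₂') (fgOver_wtPart hN hP hR h χ)
  rw [Pi.add_apply]
  exact (congrArg Nat.cast this).trans (Nat.cast_add _ _)

section Multiplication

variable {x : A} (hx : ∀ t, α t x = (w.eval t : k) • x)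
include hx

omit hA hfin in
-- Multiplication by `x` identifies Q ⧸ (Q ∩ x⁻¹P) with (P + xQ) ⧸ P, up to the shift by the weight
-- of `x`.
theorem hilb_sup_map_lsmul (hN : IsRational N.rho) (hP : N.Stable P) (hQ : N.Stable Q) :
    N.hilb P (P ⊔ Q.map (LinearMap.lsmul A _ x)) =
      shift w (N.hilb (Q ⊓ P.comap (LinearMap.lsmul A _ x)) Q) := funext fun χ => by
  rw [shift_apply, hilb_eq_of_shift hN (shift_lsmul hx N) hQ hP (sup_comm _ _) rfl,
    sub_add_cancel]

/-- The Hilbert functions of the kernel and the cokernel of multiplication by `x`. -/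
theorem hilb_sub_shift (hN : IsRational N.rho) (hP : N.Stable P) (hQ : N.Stable Q)
    (hPQ : P ≤ Q) (h : FGOver P Q) :
    N.hilb P Q - shift w (N.hilb P Q) =
      N.hilb (P ⊔ Q.map (LinearMap.lsmul A _ x)) Q -
        shift w (N.hilb P (Q ⊓ P.comap (LinearMap.lsmul A _ x))) := by
  have hxle : ∀ S : Submodule A N.carrier, S.map (LinearMap.lsmul A _ x) ≤ S := fun S => by
    rintro _ ⟨v, hv, rfl⟩
    exact S.smul_mem x hv
  have h1 := hilb_add hN hP hQ (le_sup_left : P ≤ P ⊔ Q.map (LinearMap.lsmul A _ x))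
    (sup_le hPQ (hxle Q)) h
  have h2 := hilb_add hN hP hQ (Q := Q ⊓ P.comap (LinearMap.lsmul A _ x))
    (le_inf hPQ fun v hv => P.smul_mem x hv) inf_le_left h
  have h3 := congrArg (shift w) h2
  rw [hilb_sup_map_lsmul hx hN hP hQ] at h1
  rw [map_add] at h3
  rw [h3, h1]
  abel

end Multiplication

end EqModule

end Hilbert

/-! ### Homology of an equivariant complex modulo an ideal -/

section Complex

variable {n : ℕ} {k : Type u} [Field k] {A : Type u} [CommRing A] [Algebra k A]

/-- A complex of rational equivariant modules in nonnegative degrees. -/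
structure EqComplex (α : Torus n k →* (A →ₐ[k] A)) : Type (u + 1) where
  X : ℕ → EqModule α
  d : ∀ i, (X (i + 1)).carrier →ₗ[A] (X i).carrier
  shift_d : ∀ i, (X (i + 1)).Shift (X i) 0 (d i)
  d_d : ∀ i x, d i (d (i + 1) x) = 0
  rational : ∀ i, IsRational (X i).rho

/-- The submodule `x S`. -/
abbrev smulImage {M : Type*} [AddCommGroup M] [Module A M] (x : A) (S : Submodule A M) :
    Submodule A M := S.map (LinearMap.lsmul A M x)

theorem smulImage_le {M : Type*} [AddCommGroup M] [Module A M] (x : A) (S : Submodule A M) :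
    smulImage x S ≤ S := by
  rintro _ ⟨v, hv, rfl⟩
  exact S.smul_mem x hv

theorem insert_smul_top {M : Type*} [AddCommGroup M] [Module A M] (x : A) (I : Ideal A) :
    (I ⊔ Ideal.span {x}) • (⊤ : Submodule A M) = I • ⊤ ⊔ smulImage x ⊤ := by
  rw [Submodule.sup_smul, Submodule.ideal_span_singleton_smul]
  rfl

variable {α : Torus n k →* (A →ₐ[k] A)}

namespace EqComplex

variable (K : EqComplex α) (I : Ideal A)

/-- The chains whose differential is divisible by `I`. -/
def relCycles : ∀ i, Submodule A (K.X i).carrier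
  | 0 => ⊤
  | i + 1 => (I • (⊤ : Submodule A (K.X i).carrier)).comap (K.d i)

/-- The sums of a boundary and a chain divisible by `I`. -/
def relBoundaries (i : ℕ) : Submodule A (K.X i).carrier :=
  LinearMap.range (K.d i) ⊔ I • (⊤ : Submodule A (K.X i).carrier)

/-- The Hilbert function of the homology of the reduction of the complex modulo `I`. -/
abbrev relHilb (i : ℕ) : Weight n → ℤ := (K.X i).hilb (K.relBoundaries I i) (K.relCycles I i)

variable {I} {x : A}

theorem smul_top_le_relCycles (i : ℕ) : I • (⊤ : Submodule A (K.X i).carrier) ≤ K.relCycles I i := by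
  cases i with
  | zero => exact le_top
  | succ i =>
    rw [relCycles, ← Submodule.map_le_iff_le_comap, Submodule.map_smul'']
    exact Submodule.smul_mono le_rfl le_top

theorem smul_top_le_relBoundaries (i : ℕ) :
    I • (⊤ : Submodule A (K.X i).carrier) ≤ K.relBoundaries I i := le_sup_right

theorem relBoundaries_le_relCycles (i : ℕ) : K.relBoundaries I i ≤ K.relCycles I i := by
  refine sup_le ?_ (K.smul_top_le_relCycles i)
  cases i with
  | zero => exact le_top
  | succ i =>
    rintro _ ⟨x, rfl⟩
    rw [relCycles, Submodule.mem_comap, K.d_d]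
    exact zero_mem _

theorem relBoundaries_insert (i : ℕ) : K.relBoundaries (I ⊔ Ideal.span {x}) i =
    K.relBoundaries I i ⊔ smulImage x ⊤ := by
  rw [relBoundaries, relBoundaries, insert_smul_top, sup_assoc]

section Stable

variable (hI : ∀ t, ∀ a ∈ I, α t a ∈ I)
include hI

theorem stable_relCycles (i : ℕ) : (K.X i).Stable (K.relCycles I i) := by
  cases i with
  | zero => exact EqModule.stable_top
  | succ i => exact (EqModule.stable_ideal_smul hI).comap (K.shift_d i)

theorem stable_relBoundaries (i : ℕ) : (K.X i).Stable (K.relBoundaries I i) :=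
  (EqModule.Stable.range (K.shift_d i)).sup (EqModule.stable_ideal_smul hI)

end Stable

variable (hreg : ∀ i, ∀ m : (K.X i).carrier, x • m ∈ I • (⊤ : Submodule A (K.X i).carrier) →
  m ∈ I • (⊤ : Submodule A (K.X i).carrier))

/-- The submodule of `m` such that `x m` is a boundary modulo `I`. -/
abbrev relKer (x : A) (I : Ideal A) (i : ℕ) : Submodule A (K.X i).carrier :=
  K.relCycles I i ⊓ (K.relBoundaries I i).comap (LinearMap.lsmul A _ x)

/-! ### Snake-lemma identifications for an element regular on the complex modulo `I`. -/

section Regular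

include hreg

theorem mem_relCycles_of_smul_mem {i : ℕ} {m : (K.X i).carrier} (h : x • m ∈ K.relCycles I i) :
    m ∈ K.relCycles I i := by
  cases i with
  | zero => trivial
  | succ i =>
    refine hreg i _ ?_
    rw [← map_smul]
    exact h

/-- This identifies the image of the cycles in the homology modulo (I, x) with the cokernel of `x`
on the homology modulo `I`. -/
theorem relCycles_inf_boundaries (i : ℕ) :
    K.relCycles I i ⊓ (K.relBoundaries I i ⊔ smulImage x ⊤) =
      K.relBoundaries I i ⊔ smulImage x (K.relCycles I i) := by
  refine le_antisymm ?_ (le_inf (sup_le (K.relBoundaries_le_relCycles i) (smulImage_le _ _))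
    (sup_le_sup_left (Submodule.map_mono le_top) _))
  rintro _ ⟨hz, hm⟩
  obtain ⟨b, hb, _, ⟨c, -, rfl⟩, rfl⟩ := Submodule.mem_sup.1 hm
  refine Submodule.add_mem_sup hb ⟨c, K.mem_relCycles_of_smul_mem hreg ?_, rfl⟩
  exact (add_mem_cancel_left (K.relBoundaries_le_relCycles i hb)).1 hz

/-- Together with `relKer_inf_comap`, this says that multiplication by `x` carries the kernel of `x`
on homology isomorphically to (B ∩ (xX + IX)) ⧸ (xB + IX), where X is the term of the complex and B
its boundaries modulo `I`. -/
theorem relKer_map (i : ℕ) :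
    smulImage x (K.relKer x I i) ⊔ (smulImage x (K.relBoundaries I i) ⊔ I • ⊤) =
      K.relBoundaries I i ⊓ (smulImage x ⊤ ⊔ I • ⊤) := by
  refine le_antisymm (sup_le ?_ (sup_le ?_ ?_)) ?_
  · rintro _ ⟨m, hm, rfl⟩
    exact ⟨hm.2, Submodule.mem_sup_left ⟨m, trivial, rfl⟩⟩
  · exact le_inf (smulImage_le _ _) (le_sup_of_le_left (Submodule.map_mono le_top))
  · exact le_inf (K.smul_top_le_relBoundaries i) le_sup_right
  · rintro _ ⟨hb, hm⟩
    obtain ⟨_, ⟨c, -, rfl⟩, j, hj, rfl⟩ := Submodule.mem_sup.1 hm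
    have h1 : x • c ∈ K.relBoundaries I i :=
      (add_mem_cancel_right (K.smul_top_le_relBoundaries i hj)).1 hb
    exact Submodule.add_mem_sup ⟨c, ⟨K.mem_relCycles_of_smul_mem hreg
      (K.relBoundaries_le_relCycles i h1), h1⟩, rfl⟩ (Submodule.mem_sup_right hj)

theorem relKer_inf_comap (i : ℕ) :
    K.relKer x I i ⊓ (smulImage x (K.relBoundaries I i) ⊔ I • ⊤).comap (LinearMap.lsmul A _ x) =
      K.relBoundaries I i := by
  refine le_antisymm ?_ (le_inf (le_inf (K.relBoundaries_le_relCycles i) fun b hb =>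
    Submodule.smul_mem _ x hb) fun b hb => Submodule.mem_sup_left ⟨b, hb, rfl⟩)
  rintro m ⟨-, hm⟩
  obtain ⟨_, ⟨b, hb, rfl⟩, j, hj, hbj⟩ := Submodule.mem_sup.1 hm
  have h1 : m - b ∈ I • (⊤ : Submodule A (K.X i).carrier) := hreg i _ (by
    change x • b + j = x • m at hbj
    rw [smul_sub, ← hbj, add_sub_cancel_left]
    exact hj)
  have := add_mem (K.smul_top_le_relBoundaries i h1) hb
  rwa [sub_add_cancel] at this

end Regular

/-- Together with `relCycles_insert_inf_comap`, this says that the differential maps cycles modulo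
(I, x), taken modulo the cycles for `I` and multiples of `x`, onto the same subquotient as in
`relKer_map`. Composing the two isomorphisms gives the connecting map onto the kernel of `x` one
degree lower, without ever dividing by `x`. -/
theorem map_d_relCycles_insert (i : ℕ) :
    (K.relCycles (I ⊔ Ideal.span {x}) (i + 1)).map (K.d i) ⊔
      (smulImage x (K.relBoundaries I i) ⊔ I • ⊤) =
      K.relBoundaries I i ⊓ (smulImage x ⊤ ⊔ I • ⊤) := by
  refine le_antisymm (sup_le ?_ (sup_le ?_ ?_)) ?_
  · rintro _ ⟨m, hm, rfl⟩
    refine ⟨Submodule.mem_sup_left ⟨m, rfl⟩, ?_⟩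
    rw [sup_comm, SetLike.mem_coe, ← insert_smul_top]
    exact hm
  · exact le_inf (smulImage_le _ _) (le_sup_of_le_left (Submodule.map_mono le_top))
  · exact le_inf (K.smul_top_le_relBoundaries i) le_sup_right
  · rintro _ ⟨hb, hm⟩
    obtain ⟨_, ⟨c, rfl⟩, j, hj, rfl⟩ := Submodule.mem_sup.1 hb
    refine Submodule.add_mem_sup ⟨c, ?_, rfl⟩ (Submodule.mem_sup_right hj)
    change K.d i c ∈ (I ⊔ Ideal.span {x}) • (⊤ : Submodule A (K.X i).carrier)
    rw [insert_smul_top, sup_comm]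
    exact (add_mem_cancel_right (Submodule.mem_sup_right hj)).1 hm

theorem relCycles_insert_inf_comap (i : ℕ) :
    K.relCycles (I ⊔ Ideal.span {x}) (i + 1) ⊓
      (smulImage x (K.relBoundaries I i) ⊔ I • ⊤).comap (K.d i) =
      K.relCycles I (i + 1) ⊔ smulImage x ⊤ := by
  apply le_antisymm
  · rintro z ⟨-, hz⟩
    obtain ⟨_, ⟨_, hb, rfl⟩, j, hj, hbj⟩ := Submodule.mem_sup.1 hz
    obtain ⟨_, ⟨c, rfl⟩, j', hj', rfl⟩ := Submodule.mem_sup.1 hb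
    change x • (K.d i c + j') + j = K.d i z at hbj
    refine Submodule.mem_sup.2 ⟨z - x • c, ?_, x • c, ⟨c, trivial, rfl⟩, sub_add_cancel _ _⟩
    change K.d i (z - x • c) ∈ I • (⊤ : Submodule A (K.X i).carrier)
    rw [map_sub, map_smul, ← hbj, smul_add, add_assoc, add_sub_cancel_left]
    exact add_mem (Submodule.smul_mem _ _ hj') hj
  · refine sup_le ?_ ?_
    · intro z hz
      refine ⟨?_, Submodule.mem_sup_right hz⟩
      change K.d i z ∈ (I ⊔ Ideal.span {x}) • (⊤ : Submodule A (K.X i).carrier)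
      rw [insert_smul_top]
      exact Submodule.mem_sup_left hz
    · rintro _ ⟨c, -, rfl⟩
      refine ⟨?_, ?_⟩
      · change K.d i (x • c) ∈ (I ⊔ Ideal.span {x}) • (⊤ : Submodule A (K.X i).carrier)
        rw [insert_smul_top, map_smul]
        exact Submodule.mem_sup_right ⟨_, trivial, rfl⟩
      · change K.d i (x • c) ∈ smulImage x (K.relBoundaries I i) ⊔ I • (⊤ : Submodule A (K.X i).carrier)
        rw [map_smul]
        exact Submodule.mem_sup_left ⟨_, Submodule.mem_sup_left ⟨c, rfl⟩, rfl⟩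

theorem relCycles_sup_le (i : ℕ) :
    K.relCycles I (i + 1) ⊔ smulImage x ⊤ ≤ K.relCycles (I ⊔ Ideal.span {x}) (i + 1) := by
  rw [← relCycles_insert_inf_comap]
  exact inf_le_left

theorem relBoundaries_insert_le (i : ℕ) :
    K.relBoundaries (I ⊔ Ideal.span {x}) i ≤ K.relCycles I i ⊔ smulImage x ⊤ := by
  rw [relBoundaries_insert]
  exact sup_le_sup_right (K.relBoundaries_le_relCycles i) _

section Vanishing

include hreg in
-- In the long exact sequence, the homology modulo (I, x) in degree i + 1 lies between the cokernel
-- of `x` in degree i + 1 and its kernel in degree i, both zero here.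
theorem relCycles_insert_le {i : ℕ} (h₁ : K.relCycles I (i + 1) ≤ K.relBoundaries I (i + 1))
    (h₀ : K.relCycles I i ≤ K.relBoundaries I i) :
    K.relCycles (I ⊔ Ideal.span {x}) (i + 1) ≤ K.relBoundaries (I ⊔ Ideal.span {x}) (i + 1) := by
  have h2 : K.relCycles (I ⊔ Ideal.span {x}) (i + 1) ≤ K.relCycles I (i + 1) ⊔ smulImage x ⊤ := by
    rw [← relCycles_insert_inf_comap]
    refine le_inf le_rfl ?_
    rw [← Submodule.map_le_iff_le_comap]
    refine (le_sup_left.trans_eq (K.map_d_relCycles_insert i)).trans ?_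
    rw [← K.relKer_map hreg]
    refine sup_le (le_sup_of_le_left (Submodule.map_mono ?_)) le_rfl
    exact inf_le_left.trans h₀
  rw [relBoundaries_insert]
  exact h2.trans (sup_le_sup_right h₁ _)

end Vanishing

section Finiteness

theorem fgOver_sup_smulImage {i : ℕ} (h : FGOver (K.relBoundaries I i) (K.relCycles I i)) :
    FGOver (K.relBoundaries (I ⊔ Ideal.span {x}) i) (K.relCycles I i ⊔ smulImage x ⊤) := by
  rw [relBoundaries_insert]
  refine (h.of_le le_sup_left (sup_le (K.relBoundaries_le_relCycles i) (smulImage_le x _))).map_sup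
    LinearMap.id ?_ ?_
  · rw [Submodule.map_id, ← sup_assoc, sup_eq_left.2 (K.relBoundaries_le_relCycles i)]
  · rw [Submodule.comap_id]
    exact sup_le_sup_left (Submodule.map_mono le_top) _

include hreg in
-- The new homology is an extension of a kernel by a cokernel of `x`; the kernel is finitely
-- generated because `A` is Noetherian.
theorem fgOver_relCycles_insert [IsNoetherianRing A] {i : ℕ}
    (h₁ : FGOver (K.relBoundaries I (i + 1)) (K.relCycles I (i + 1)))
    (h₀ : FGOver (K.relBoundaries I i) (K.relCycles I i)) :
    FGOver (K.relBoundaries (I ⊔ Ideal.span {x}) (i + 1))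
      (K.relCycles (I ⊔ Ideal.span {x}) (i + 1)) := by
  refine (K.fgOver_sup_smulImage h₁).trans ?_
  have h2 : FGOver (K.relBoundaries I i) (K.relKer x I i) := h₀.restrict
    (le_inf (K.relBoundaries_le_relCycles i) fun b hb => Submodule.smul_mem _ x hb) inf_le_left
  exact (h2.map_sup _ (K.relKer_map hreg i) fun b hb => Submodule.mem_sup_left
    ⟨b, hb, rfl⟩).of_map_sup (K.map_d_relCycles_insert i) (K.relCycles_insert_inf_comap i)

end Finiteness

/-! ### The long exact sequence at the level of Hilbert functions. -/

section HilbertFunction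

variable [Infinite k] [hA : Fact (IsRational (funRep α))]
  [hfin : ∀ χ, Module.Finite k (weightSpace (funRep α) χ)]
  {w : Weight n} (hx : ∀ t, α t x = (w.eval t : k) • x) (hI : ∀ t, ∀ a ∈ I, α t a ∈ I)

include hx hI in
omit [Infinite k] hA hfin in
theorem map_mem_insert (t : Torus n k) (a : A) (ha : a ∈ I ⊔ Ideal.span {x}) :
    α t a ∈ I ⊔ Ideal.span {x} := by
  obtain ⟨b, hb, c, hc, rfl⟩ := Submodule.mem_sup.1 ha
  obtain ⟨e, rfl⟩ := Ideal.mem_span_singleton'.1 hc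
  rw [map_add, map_mul, hx]
  refine Submodule.add_mem_sup (hI t b hb) ?_
  rw [mul_smul_comm, ← smul_mul_assoc]
  exact Ideal.mul_mem_left _ _ (Ideal.mem_span_singleton_self x)

include hreg hx hI

/-- The image of `x` on the homology in degree `i`. -/
theorem relHilb_eq_add {i : ℕ} (h : FGOver (K.relBoundaries I i) (K.relCycles I i)) :
    K.relHilb I i =
      (K.X i).hilb (K.relBoundaries I i) (K.relBoundaries I i ⊔ smulImage x (K.relCycles I i)) +
      (K.X i).hilb (K.relBoundaries (I ⊔ Ideal.span {x}) i) (K.relCycles I i ⊔ smulImage x ⊤) := by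
  have hB := K.stable_relBoundaries hI i
  have hZ := K.stable_relCycles hI i
  have hs := EqModule.shift_lsmul hx (K.X i)
  rw [relHilb, EqModule.hilb_add (K.rational i) hB hZ (le_sup_left : _ ≤ K.relBoundaries I i ⊔
    smulImage x (K.relCycles I i)) (sup_le (K.relBoundaries_le_relCycles i) (smulImage_le x _)) h]
  congr 1
  rw [relBoundaries_insert]
  refine EqModule.hilb_eq (K.rational i) EqModule.shift_id hZ
    (hB.sup (EqModule.stable_top.map hs)) ?_ ?_
  · rw [Submodule.map_id, ← sup_assoc, sup_eq_left.2 (K.relBoundaries_le_relCycles i)]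
  · rw [Submodule.comap_id, K.relCycles_inf_boundaries hreg]

/-- In degree 0 every chain is a cycle, so the long exact sequence ends with the cokernel of `x`. -/
theorem relHilb_insert_zero (h : FGOver (K.relBoundaries I 0) (K.relCycles I 0)) :
    K.relHilb (I ⊔ Ideal.span {x}) 0 = K.relHilb I 0 -
      (K.X 0).hilb (K.relBoundaries I 0) (K.relBoundaries I 0 ⊔ smulImage x (K.relCycles I 0)) := by
  rw [K.relHilb_eq_add hreg hx hI h, add_sub_cancel_left, relCycles, top_sup_eq]
  rfl

/-- The first difference is the cokernel of `x` in degree i + 1. The last bracket is the shifted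
kernel of `x` in degree i: since `x` has weight `w`, the image of `x` is the shift of homology
modulo that kernel. -/
theorem relHilb_insert_succ [IsNoetherianRing A] {i : ℕ}
    (h₁ : FGOver (K.relBoundaries I (i + 1)) (K.relCycles I (i + 1)))
    (h₀ : FGOver (K.relBoundaries I i) (K.relCycles I i)) :
    K.relHilb (I ⊔ Ideal.span {x}) (i + 1) = K.relHilb I (i + 1) -
      (K.X (i + 1)).hilb (K.relBoundaries I (i + 1))
        (K.relBoundaries I (i + 1) ⊔ smulImage x (K.relCycles I (i + 1))) +
      (shift w (K.relHilb I i) - (K.X i).hilb (K.relBoundaries I i)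
        (K.relBoundaries I i ⊔ smulImage x (K.relCycles I i))) := by
  have hI' := map_mem_insert hx hI
  have hB := K.stable_relBoundaries hI i
  have hZ := K.stable_relCycles hI i
  have hs := EqModule.shift_lsmul hx (K.X i)
  have hP' : (K.X i).Stable (smulImage x (K.relBoundaries I i) ⊔ I • ⊤) :=
    (hB.map hs).sup (EqModule.stable_ideal_smul hI)
  have hle : K.relBoundaries I i ≤ K.relKer x I i :=
    le_inf (K.relBoundaries_le_relCycles i) fun b hb => Submodule.smul_mem _ x hb
  rw [K.relHilb_eq_add hreg hx hI h₁, add_sub_cancel_left, relHilb,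
    EqModule.hilb_add (K.rational (i + 1)) (K.stable_relBoundaries hI' _)
      (K.stable_relCycles hI' _) (K.relBoundaries_insert_le (i + 1)) (K.relCycles_sup_le i)
      (K.fgOver_relCycles_insert hreg h₁ h₀)]
  congr 1
  rw [EqModule.hilb_eq (K.rational (i + 1)) (K.shift_d i) (K.stable_relCycles hI' _) hP'
    (K.map_d_relCycles_insert i) (K.relCycles_insert_inf_comap i)]
  have h3 : (K.X i).hilb (smulImage x (K.relBoundaries I i) ⊔ I • ⊤)
      (K.relBoundaries I i ⊓ (smulImage x ⊤ ⊔ I • ⊤)) =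
      shift w ((K.X i).hilb (K.relBoundaries I i) (K.relKer x I i)) := funext fun χ => by
    rw [shift_apply, EqModule.hilb_eq_of_shift (K.rational i) hs (hZ.inf (hB.comap hs)) hP'
      (K.relKer_map hreg i) (K.relKer_inf_comap hreg i), sub_add_cancel]
  rw [h3, EqModule.hilb_sup_map_lsmul hx (K.rational i) hB hZ, ← map_sub]
  congr 1
  rw [relHilb, EqModule.hilb_add (K.rational i) hB hZ hle inf_le_left h₀, add_sub_cancel_right]

end HilbertFunction

end EqComplex

end Complex

/-! ### Euler characteristics modulo a regular sequence -/

section Euler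

variable {n : ℕ} {k : Type u} [Field k] {A : Type u} [CommRing A] [Algebra k A]
  {α : Torus n k →* (A →ₐ[k] A)}

/-- The action of the representation ring on functions on the weight lattice by convolution. -/
def convolution : RepRing n →ₐ[ℤ] Module.End ℤ (Weight n → ℤ) :=
  AddMonoidAlgebra.lift ℤ _ _
    { toFun := fun χ => shift χ.toAdd
      map_one' := LinearMap.ext fun f => funext fun χ => by simp
      map_mul' := fun χ ψ => LinearMap.ext fun f => funext fun ω => by
        simp [sub_sub] }

theorem convolution_single (w : Weight n) :
    convolution (AddMonoidAlgebra.single w 1) = shift w := by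
  rw [convolution, AddMonoidAlgebra.lift_single, one_smul]
  rfl

/-- The terms `q i` count the image of the new element on homology. Each occurs in two consecutive
degrees with opposite signs, so only the last one survives truncation. -/
theorem sum_neg_one_pow_smul {G : Type*} [AddCommGroup G] (σ : Module.End ℤ G) (h h' q : ℕ → G)
    (h0 : h' 0 = h 0 - q 0) (hs : ∀ i, h' (i + 1) = h (i + 1) - q (i + 1) + (σ (h i) - q i))
    (m : ℕ) : ∑ i ∈ Finset.range (m + 1), (-1 : ℤ) ^ i • h' i =
      ∑ i ∈ Finset.range (m + 1), (-1 : ℤ) ^ i • h i -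
        σ (∑ i ∈ Finset.range m, (-1 : ℤ) ^ i • h i) - (-1 : ℤ) ^ m • q m := by
  induction m with
  | zero => simp [h0]
  | succ m ih =>
    rw [Finset.sum_range_succ, ih, Finset.sum_range_succ _ (m + 1), Finset.sum_range_succ _ m,
      hs, map_add, map_smul, pow_succ]
    module

variable {σ : Type*} (X : σ → A)

/-- The ideal generated by a set of coordinates. -/
def varIdeal (S : Finset σ) : Ideal A := Ideal.span (X '' (S : Set σ))

theorem varIdeal_empty : varIdeal X (∅ : Finset σ) = ⊥ := by simp [varIdeal]

theorem varIdeal_insert [DecidableEq σ] (S : Finset σ) (s : σ) :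
    varIdeal X (insert s S) = varIdeal X S ⊔ Ideal.span {X s} := by
  rw [varIdeal, Finset.coe_insert, Set.image_insert_eq, Ideal.span_insert, sup_comm]
  rfl

variable {X} in
theorem map_mem_varIdeal {w : σ → Weight n} (hX : ∀ s t, α t (X s) = ((w s).eval t : k) • X s)
    (S : Finset σ) (t : Torus n k) (a : A) (ha : a ∈ varIdeal X S) : α t a ∈ varIdeal X S := by
  have : varIdeal X S ≤ (varIdeal X S).comap (α t) := by
    rw [varIdeal, Ideal.span_le]
    rintro _ ⟨s, hs, rfl⟩
    change α t (X s) ∈ Ideal.span _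
    rw [hX, Algebra.smul_def]
    exact Ideal.mul_mem_left _ _ (Ideal.subset_span ⟨s, hs, rfl⟩)
  exact this ha

namespace EqComplex

variable [Infinite k] [IsNoetherianRing A] [hA : Fact (IsRational (funRep α))]
  [hfin : ∀ χ, Module.Finite k (weightSpace (funRep α) χ)] (K : EqComplex α) {X}
  {w : σ → Weight n}

/-- For a complex which is a resolution, the homology modulo a regular sequence of weight vectors
is finitely generated and vanishes in degrees beyond the length of the sequence. Its Euler
characteristic is given by the Koszul formula. -/
theorem euler_varIdeal (hX : ∀ s t, α t (X s) = ((w s).eval t : k) • X s)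
    (hreg : ∀ S : Finset σ, ∀ s ∉ S, ∀ i, ∀ m : (K.X i).carrier,
      X s • m ∈ varIdeal X S • (⊤ : Submodule A (K.X i).carrier) →
      m ∈ varIdeal X S • (⊤ : Submodule A (K.X i).carrier))
    (hfg : FGOver (K.relBoundaries ⊥ 0) (K.relCycles ⊥ 0))
    (hex : ∀ i, K.relCycles ⊥ (i + 1) ≤ K.relBoundaries ⊥ (i + 1)) (S : Finset σ) :
    (∀ i, FGOver (K.relBoundaries (varIdeal X S) i) (K.relCycles (varIdeal X S) i)) ∧
    (∀ i, S.card < i → K.relCycles (varIdeal X S) i ≤ K.relBoundaries (varIdeal X S) i) ∧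
    ∀ m, S.card < m → ∑ i ∈ Finset.range m, (-1 : ℤ) ^ i • K.relHilb (varIdeal X S) i =
      convolution (∏ s ∈ S, (1 - AddMonoidAlgebra.single (w s) 1)) (K.relHilb ⊥ 0) := by
  classical
  induction S using Finset.induction_on with
  | empty =>
    rw [varIdeal_empty]
    refine ⟨fun i => ?_, fun i hi => ?_, fun m hm => ?_⟩
    · cases i with
      | zero => exact hfg
      | succ i => exact le_antisymm (hex i) (K.relBoundaries_le_relCycles _) ▸ FGOver.refl _
    · obtain ⟨i, rfl⟩ := Nat.exists_eq_succ_of_ne_zero (Nat.pos_iff_ne_zero.1 hi)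
      exact hex i
    · obtain ⟨m, rfl⟩ := Nat.exists_eq_succ_of_ne_zero (Nat.pos_iff_ne_zero.1 hm)
      rw [Finset.sum_range_succ', Finset.sum_eq_zero fun i _ => by
        rw [relHilb, EqModule.hilb_of_le (hex i), smul_zero]]
      simp
  | insert s S hs ih =>
    obtain ⟨h1, h2, h3⟩ := ih
    have hr := hreg S s hs
    have hI := map_mem_varIdeal hX S
    rw [varIdeal_insert, Finset.card_insert_of_notMem hs]
    refine ⟨fun i => ?_, fun i hi => ?_, fun m hm => ?_⟩
    · cases i with
      | zero =>
        have := K.fgOver_sup_smulImage (x := X s) (h1 0)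
        rwa [relCycles, top_sup_eq] at this
      | succ i => exact K.fgOver_relCycles_insert hr (h1 _) (h1 _)
    · obtain ⟨i, rfl⟩ := Nat.exists_eq_succ_of_ne_zero (Nat.ne_zero_of_lt hi)
      exact K.relCycles_insert_le hr (h2 _ (by lia)) (h2 _ (by lia))
    · obtain ⟨m, rfl⟩ := Nat.exists_eq_succ_of_ne_zero (Nat.ne_zero_of_lt hm)
      -- Both truncations, at `m` and `m + 1`, exceed the length for `S`, so both sums are given by
      -- the induction hypothesis; the leftover image term vanishes because the homology in degree
      -- `m` does.
      have hm' : S.card < m := by lia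
      rw [sum_neg_one_pow_smul (shift (w s)) (K.relHilb (varIdeal X S)) _
        (fun i => (K.X i).hilb (K.relBoundaries (varIdeal X S) i) (K.relBoundaries (varIdeal X S) i ⊔
          smulImage (X s) (K.relCycles (varIdeal X S) i)))
        (K.relHilb_insert_zero hr (hX s) hI (h1 0))
        (fun i => K.relHilb_insert_succ hr (hX s) hI (h1 _) (h1 _)), h3 _ (by lia), h3 _ hm',
        EqModule.hilb_of_le (sup_le le_rfl ((smulImage_le _ _).trans (h2 m hm'))),
        Finset.prod_insert hs, map_mul, map_sub, convolution_single, map_one]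
      simp

end EqComplex

end Euler

/-! ### The canonical resolution -/

section Resolution

variable {n : ℕ} {k : Type u} [Field k] [Infinite k] {A : Type u} [CommRing A] [Algebra k A]
  {α : Torus n k →* (A →ₐ[k] A)}

namespace EqModule

omit [Infinite k] in
theorem aug_surjective (N : EqModule α) : Function.Surjective N.aug := fun m =>
  ⟨1 ⊗ₜ m, by simp [aug]⟩

/-- Rationality passes to tensor products and to equivariant submodules, hence to each syzygy. -/
theorem isRational_syzygy [hA : Fact (IsRational (funRep α))] {M : EqModule α}
    (hM : IsRational M.rho) (i : ℕ) : IsRational (M.syzygy i).rho := by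
  induction i with
  | zero => exact hM
  | succ i ih =>
    exact IsRational.of_injective (ρ' := (M.syzygy i).free.rho) (hA.out.tprod ih)
      (g := (LinearMap.ker (M.syzygy i).aug).subtype.restrictScalars k)
      (isShift_zero fun _ _ => rfl) Subtype.val_injective

/-- The canonical free resolution of a rational module. -/
abbrev resComplex [hA : Fact (IsRational (funRep α))] (M : EqModule α) (hM : IsRational M.rho) :
    EqComplex α where
  X := M.res
  d := M.resD
  shift_d i := isShift_zero (M.resD_rho i)
  d_d i x := congrArg Subtype.val (LinearMap.mem_ker.1 ((M.syzygy (i + 2)).aug x).2 :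
    (M.syzygy (i + 1)).aug _ = 0)
  rational i := hA.out.tprod (isRational_syzygy hM i)

variable [hA : Fact (IsRational (funRep α))] {M : EqModule α} (hM : IsRational M.rho)

omit [Infinite k] hA in
theorem range_resD (i : ℕ) :
    LinearMap.range (M.resD i) = LinearMap.ker (M.syzygy i).aug := by
  ext x
  constructor
  · rintro ⟨y, rfl⟩
    exact ((M.syzygy (i + 1)).aug y).2
  · intro hx
    obtain ⟨y, hy⟩ := aug_surjective (M.syzygy (i + 1)) ⟨x, hx⟩
    exact ⟨y, congrArg Subtype.val hy⟩

omit [Infinite k] hA in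
theorem ker_resD (i : ℕ) :
    LinearMap.ker (M.resD i) = LinearMap.ker (M.syzygy (i + 1)).aug := by
  ext x
  exact ⟨fun h => Subtype.ext h, fun h => congrArg Subtype.val h⟩

theorem resComplex_exact (i : ℕ) :
    (M.resComplex hM).relCycles ⊥ (i + 1) ≤ (M.resComplex hM).relBoundaries ⊥ (i + 1) := by
  refine le_sup_of_le_left ?_
  change Submodule.comap (M.resD i) _ ≤ LinearMap.range (M.resD (i + 1))
  rw [Submodule.bot_smul, range_resD, ← ker_resD]
  exact le_rfl

theorem resComplex_relBoundaries_zero :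
    (M.resComplex hM).relBoundaries ⊥ 0 = LinearMap.ker M.aug := by
  rw [EqComplex.relBoundaries, Submodule.bot_smul, sup_bot_eq]
  exact range_resD 0

theorem resComplex_fgOver [Module.Finite A M.carrier] :
    FGOver ((M.resComplex hM).relBoundaries ⊥ 0) ((M.resComplex hM).relCycles ⊥ 0) := by
  have h : FGOver (⊥ : Submodule A M.carrier) ⊤ := ⟨⊤, Module.Finite.fg_top, by simp⟩
  refine h.of_map_sup (g := M.aug) ?_ ?_
  · rw [EqComplex.relCycles, sup_bot_eq]
    exact (LinearMap.range_eq_map M.aug).symm.trans (LinearMap.range_eq_top.2 (aug_surjective M))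
  · rw [EqComplex.relCycles, top_inf_eq, resComplex_relBoundaries_zero]
    rfl

/-- The augmentation identifies the degree 0 homology of the resolution with `M`. -/
theorem resComplex_relHilb : (M.resComplex hM).relHilb ⊥ 0 = M.hilb ⊥ ⊤ := by
  refine hilb_eq ((M.resComplex hM).rational 0) (g := M.aug) (isShift_zero M.aug_rho) stable_top
    stable_bot ?_ ?_
  · rw [EqComplex.relCycles, sup_bot_eq]
    exact (LinearMap.range_eq_map M.aug).symm.trans (LinearMap.range_eq_top.2 (aug_surjective M))
  · rw [EqComplex.relCycles, top_inf_eq, resComplex_relBoundaries_zero]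
    rfl

end EqModule

end Resolution

/-! ### The class of `Tor` in the representation ring -/

section Tor

variable {n : ℕ} {k : Type u} [Field k]

/-- `A` acts on Q ⧸ P through `ε`, so generators over `A` already span over `k`; write a = (a - ε a)
+ ε a. -/
theorem FGOver.restrictScalars {A : Type*} [CommRing A] [Algebra k A] {N : Type*} [AddCommGroup N]
    [Module k N] [Module A N] [IsScalarTower k A N] {P Q : Submodule A N} (h : FGOver P Q)
    (ε : A →ₐ[k] k) (hker : ∀ a ∈ RingHom.ker ε, ∀ q ∈ Q, a • q ∈ P) :
    FGOver (P.restrictScalars k) (Q.restrictScalars k) := by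
  obtain ⟨_, ⟨s, rfl⟩, hS⟩ := h
  refine ⟨Submodule.span k (s : Set N), ⟨s, rfl⟩, le_antisymm (sup_le ?_ ?_) ?_⟩
  · exact hS ▸ le_sup_left (a := P)
  · rw [Submodule.span_le]
    intro m hm
    change m ∈ Q
    rw [← hS]
    exact Submodule.mem_sup_right (Submodule.subset_span hm)
  · intro q hq
    have hq' : q ∈ P ⊔ Submodule.span A (s : Set N) := by rw [hS]; exact hq
    obtain ⟨p, hp, y, hy, rfl⟩ := Submodule.mem_sup.1 hq'
    refine add_mem (Submodule.mem_sup_left hp) ?_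
    have hyQ : y ∈ Q := hS ▸ Submodule.mem_sup_right hy
    clear hq hq'
    induction hy using Submodule.span_induction with
    | mem m hm => exact Submodule.mem_sup_right (Submodule.subset_span hm)
    | zero => exact zero_mem _
    | add a b ha hb iha ihb =>
      exact add_mem (iha (hS ▸ Submodule.mem_sup_right ha))
        (ihb (hS ▸ Submodule.mem_sup_right hb))
    | smul a m hm ih =>
      have hmQ : m ∈ Q := hS ▸ Submodule.mem_sup_right hm
      have h1 : a • m = (a - algebraMap k A (ε a)) • m + ε a • m := by
        rw [sub_smul, algebraMap_smul, sub_add_cancel]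
      rw [h1]
      refine add_mem (Submodule.mem_sup_left (hker _ ?_ m hmQ)) (Submodule.smul_mem _ _ (ih hmQ))
      rw [RingHom.mem_ker, map_sub]
      exact sub_eq_zero.2 (ε.commutes (ε a)).symm

variable {V V' : Type u} [AddCommGroup V] [Module k V]

section Rep

variable (ρ : Representation k (Torus n k) V)

theorem wtPart_top (χ : Weight n) : wtPart ρ ⊤ χ = weightSpace ρ χ := top_inf_eq _

theorem wtPart_bot (χ : Weight n) : wtPart ρ ⊥ χ = ⊥ := bot_inf_eq _

variable {ρ} [Infinite k]

/-- Only weights occurring in the finitely many generators can occur in the quotient. -/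
theorem finite_setOf_relDim_ne_zero (hV : IsRational ρ) {P Q : Submodule k V}
    (hP : IsStable ρ (P : Set V)) (h : FGOver P Q) :
    {χ | relDim (wtPart ρ P χ) (wtPart ρ Q χ) ≠ 0}.Finite := by
  classical
  obtain ⟨_, ⟨s, rfl⟩, rfl⟩ := h
  choose c hc hcs using hV.exists_sum
  refine (s.biUnion fun m => (c m).support).finite_toSet.subset fun χ hχ => ?_
  by_contra hχs
  refine hχ (relDim_of_le ?_)
  rintro q ⟨hq, hqχ⟩
  have key : ∀ y ∈ Submodule.span k (s : Set V), ∃ b : Weight n →₀ V,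
      (∀ ψ, b ψ ∈ weightSpace ρ ψ) ∧ (b.sum fun _ v => v) = y ∧ b χ = 0 := by
    intro y hy
    induction hy using Submodule.span_induction with
    | mem y hy =>
      refine ⟨c y, hc y, hcs y, Finsupp.notMem_support_iff.1 fun h => hχs ?_⟩
      exact Finset.mem_biUnion.2 ⟨y, hy, h⟩
    | zero => exact ⟨0, fun _ => zero_mem _, by simp, rfl⟩
    | add y y' _ _ h h' =>
      obtain ⟨b, h1, h2, h3⟩ := h
      obtain ⟨b', h1', h2', h3'⟩ := h'
      refine ⟨b + b', fun ψ => add_mem (h1 ψ) (h1' ψ), ?_, by simp [h3, h3']⟩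
      rw [Finsupp.sum_add_index' (by simp) (by simp), h2, h2']
    | smul a y _ h =>
      obtain ⟨b, h1, h2, h3⟩ := h
      refine ⟨a • b, fun ψ => Submodule.smul_mem _ _ (h1 ψ), ?_, by simp [h3]⟩
      rw [Finsupp.sum_smul_index' (by simp), ← h2, Finsupp.smul_sum]
  obtain ⟨p, hp, y, hy, rfl⟩ := Submodule.mem_sup.1 hq
  obtain ⟨b, hb, rfl, hb0⟩ := key y hy
  refine ⟨?_, hqχ⟩
  -- The element of `P` decomposes as q - y. Its `χ`-component is q itself, since y has none, and
  -- stability of `P` gives q ∈ P.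
  have := hP.component_mem (c := Finsupp.single χ (p + b.sum fun _ v => v) - b) (fun ψ => by
    rw [Finsupp.sub_apply, Finsupp.single_apply]
    refine sub_mem ?_ (hb ψ)
    split_ifs with e
    · exact e ▸ hqχ
    · exact zero_mem _) (by
    rw [Finsupp.sum_sub_index (by simp), Finsupp.sum_single_index rfl, add_sub_cancel_right]
    exact hp) χ
  simpa [hb0] using this

omit [Infinite k] in
-- Finite support is needed because `finsum` is 0 on families of infinite support.
theorem ch_coeff (h : {χ | Module.finrank k (weightSpace ρ χ) ≠ 0}.Finite) (χ : Weight n) :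
    (ch ρ).coeff χ = Module.finrank k (weightSpace ρ χ) := by
  classical
  rw [ch, finsum_eq_sum_of_support_subset (s := h.toFinset) _ (fun ψ hψ => by
    rw [Finset.mem_coe, Set.Finite.mem_toFinset]
    intro h0
    exact hψ (by simp [h0])), AddMonoidAlgebra.coeff_sum, Finsupp.finsetSum_apply]
  simp only [AddMonoidAlgebra.coeff_single, Finsupp.single_apply]
  rw [Finset.sum_ite_eq']
  split_ifs with hχ
  · rfl
  · simpa using congrArg (Nat.cast (R := ℤ)) (show _ = 0 by simpa using hχ).symm

/-- Weight spaces of subquotients of a rational representation. -/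
theorem finrank_weightSpace_quotient (hV : IsRational ρ) {P Q : Submodule k V} (hPQ : P ≤ Q)
    (hP : IsStable ρ (P : Set V)) (hQ : ∀ t, Q ≤ Q.comap (ρ t))
    (h : ∀ t, P.comap Q.subtype ≤ (P.comap Q.subtype).comap (ρ.subrepresentation Q hQ t))
    (χ : Weight n) :
    Module.finrank k
      (weightSpace ((ρ.subrepresentation Q hQ).quotient (P.comap Q.subtype) h) χ) =
      relDim (wtPart ρ P χ) (wtPart ρ Q χ) := by
  have hs : IsShift (ρ.subrepresentation Q hQ) ρ 0 Q.subtype := isShift_zero fun _ _ => rfl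
  have hr := IsRational.of_injective hV hs Q.injective_subtype
  have e1 := relDim_wtPart_eq hr hs (P := P.comap Q.subtype) (Q := ⊤) (P' := P) (Q' := Q)
    (fun _ _ _ => trivial) hP (by simpa using hPQ) (top_inf_eq _) χ
  have e2 := relDim_wtPart_eq hr (isShift_zero fun _ _ => rfl :
    IsShift _ ((ρ.subrepresentation Q hQ).quotient (P.comap Q.subtype) h) 0
      (P.comap Q.subtype).mkQ) (P := P.comap Q.subtype) (Q := ⊤) (P' := ⊥) (Q' := ⊤)
    (fun _ _ _ => trivial) (fun t v hv => by
      rw [SetLike.mem_coe, Submodule.mem_bot] at hv ⊢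
      rw [hv, map_zero]) (by simp) (by simp) χ
  rw [add_zero] at e1 e2
  rw [← e1, e2, wtPart_top, wtPart_bot, relDim_bot]

end Rep

variable [Infinite k] {A : Type u} [CommRing A] [Algebra k A] {α : Torus n k →* (A →ₐ[k] A)}
  {ε : A →ₐ[k] k} (hε : ∀ t a, ε (α t a) = ε a)
  [hA : Fact (IsRational (funRep α))]

namespace EqModule

variable {M : EqModule α} (hM : IsRational M.rho)

/-- With `relCycles_inf_comap_mkQ`, this identifies the homology of the complex of fibres with the
relative homology modulo the maximal ideal, computed inside the resolution itself. -/
theorem map_mkQ_relCycles (i : ℕ) :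
    (((M.resComplex hM).relCycles (RingHom.ker ε) i).restrictScalars k).map
      ((M.res i).maxSMul ε).mkQ ⊔ M.boundaries ε i = M.cycles ε i := by
  cases i with
  | zero =>
    refine eq_top_iff.2 fun u _ => ?_
    obtain ⟨z, rfl⟩ := Submodule.mkQ_surjective _ u
    exact Submodule.mem_sup_left ⟨z, trivial, rfl⟩
  | succ i =>
    refine le_antisymm (sup_le ?_ ?_) ?_
    · rintro _ ⟨z, hz, rfl⟩
      exact (Submodule.Quotient.mk_eq_zero ((M.res i).maxSMul ε)).2 hz
    · rintro _ ⟨u, rfl⟩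
      obtain ⟨z, rfl⟩ := Submodule.mkQ_surjective _ u
      refine (Submodule.Quotient.mk_eq_zero ((M.res i).maxSMul ε)).2 ?_
      have h0 : M.resD i (M.resD (i + 1) z) = 0 := (M.resComplex hM).d_d i z
      change M.resD i (M.resD (i + 1) z) ∈ (M.res i).maxSMul ε
      rw [h0]
      exact zero_mem _
    · intro u hu
      obtain ⟨z, rfl⟩ := Submodule.mkQ_surjective _ u
      exact Submodule.mem_sup_left
        ⟨z, (Submodule.Quotient.mk_eq_zero ((M.res i).maxSMul ε)).1 hu, rfl⟩

theorem relCycles_inf_comap_mkQ (i : ℕ) :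
    ((M.resComplex hM).relCycles (RingHom.ker ε) i).restrictScalars k ⊓
      (M.boundaries ε i).comap ((M.res i).maxSMul ε).mkQ =
      ((M.resComplex hM).relBoundaries (RingHom.ker ε) i).restrictScalars k := by
  apply le_antisymm
  · rintro (z : (M.res i).carrier) ⟨-, u, hu⟩
    obtain ⟨y, rfl⟩ := Submodule.mkQ_surjective _ u
    have h1 : M.resD i y - z ∈ (M.res i).maxSMul ε := (Submodule.Quotient.eq _).1 hu
    have h2 : M.resD i y - (M.resD i y - z) ∈ (M.resComplex hM).relBoundaries (RingHom.ker ε) i :=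
      sub_mem (Submodule.mem_sup_left ⟨y, rfl⟩) (Submodule.mem_sup_right h1)
    rwa [sub_sub_cancel] at h2
  · refine le_inf ((M.resComplex hM).relBoundaries_le_relCycles i) ?_
    intro (z : (M.res i).carrier) hz
    obtain ⟨_, ⟨y, rfl⟩, (j : (M.res i).carrier), hj, rfl⟩ := Submodule.mem_sup.1
      (show z ∈ (M.resComplex hM).relBoundaries (RingHom.ker ε) i from hz)
    refine ⟨((M.res (i + 1)).maxSMul ε).mkQ y, ?_⟩
    refine (Submodule.Quotient.eq ((M.res i).maxSMul ε)).2 ?_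
    have hj' : j ∈ (M.res i).maxSMul ε := hj
    change M.resD i y - (M.resD i y + j) ∈ (M.res i).maxSMul ε
    rw [sub_add_cancel_left]
    exact neg_mem hj'

include hε in
omit [Infinite k] hA in
theorem map_mem_ker (t : Torus n k) (a : A) (ha : a ∈ RingHom.ker ε) : α t a ∈ RingHom.ker ε :=
  (hε t a).trans ha

/-- The dimensions of the weight spaces of `Tor`. -/
theorem finrank_weightSpace_torRep (i : ℕ) (χ : Weight n) :
    (Module.finrank k (weightSpace (M.torRep hε i) χ) : ℤ) =
      (M.resComplex hM).relHilb (RingHom.ker ε) i χ := by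
  have hr : IsRational (M.res i).rho := (M.resComplex hM).rational i
  have hs : IsShift (M.res i).rho ((M.res i).fibreRep hε) 0 ((M.res i).maxSMul ε).mkQ :=
    isShift_zero fun _ _ => rfl
  have hI := map_mem_ker hε
  have hZ := (M.resComplex hM).stable_relCycles hI i
  have hB : IsStable ((M.res i).fibreRep hε) (M.boundaries ε i : Set ((M.res i).Fibre ε)) :=
    fun t _ hx => M.boundaries_le hε i t hx
  have e1 := finrank_weightSpace_quotient (hr.of_surjective hs (Submodule.mkQ_surjective _))
    (show M.boundaries ε i ≤ M.cycles ε i by rw [← map_mkQ_relCycles hM]; exact le_sup_right) hB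
    (M.cycles_le hε i) (fun t _ hx => M.boundaries_le hε i t hx) χ
  have e2 := relDim_wtPart_eq hr hs hZ hB (map_mkQ_relCycles hM i) (relCycles_inf_comap_mkQ hM i) χ
  rw [add_zero] at e2
  exact congrArg Nat.cast (e1.trans e2.symm)

/-- If the homology modulo the maximal ideal is finitely generated and vanishes in high degrees,
then the class of `Tor` is its Euler characteristic. -/
theorem coeff_torClass (hfg : ∀ i, FGOver ((M.resComplex hM).relBoundaries (RingHom.ker ε) i)
      ((M.resComplex hM).relCycles (RingHom.ker ε) i)) {m : ℕ}
    (hm : ∀ i, m ≤ i → (M.resComplex hM).relCycles (RingHom.ker ε) i ≤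
      (M.resComplex hM).relBoundaries (RingHom.ker ε) i) :
    ((M.torClass hε).coeff : Weight n → ℤ) =
      ∑ i ∈ Finset.range m, (-1 : ℤ) ^ i • (M.resComplex hM).relHilb (RingHom.ker ε) i := by
  have hch : ∀ i, ((ch (M.torRep hε i)).coeff : Weight n → ℤ) =
      (M.resComplex hM).relHilb (RingHom.ker ε) i := by
    intro i
    have hfin := finite_setOf_relDim_ne_zero ((M.resComplex hM).rational i)
      (P := ((M.resComplex hM).relBoundaries (RingHom.ker ε) i).restrictScalars k)
      (Q := ((M.resComplex hM).relCycles (RingHom.ker ε) i).restrictScalars k)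
      ((M.resComplex hM).stable_relBoundaries (map_mem_ker hε) i)
      ((hfg i).restrictScalars ε fun a ha q _ =>
        Submodule.mem_sup_right (Submodule.smul_mem_smul ha trivial))
    funext χ
    rw [← finrank_weightSpace_torRep hε hM]
    refine ch_coeff (hfin.subset fun ψ hψ h0 => hψ ?_) χ
    have := finrank_weightSpace_torRep hε hM i ψ
    rw [EqComplex.relHilb, hilb, h0] at this
    exact_mod_cast this
  rw [torClass, finsum_eq_sum_of_support_subset (s := Finset.range m) _ (fun i hi => by
    rw [Finset.mem_coe, Finset.mem_range]
    by_contra hmi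
    refine hi ?_
    have h0 : ch (M.torRep hε i) = 0 := by
      rw [← AddMonoidAlgebra.coeff_eq_zero]
      exact DFunLike.coe_injective ((hch i).trans (hilb_of_le (hm i (not_lt.1 hmi))))
    simp [h0])]
  funext χ
  rw [AddMonoidAlgebra.coeff_sum, Finsupp.finsetSum_apply, Finset.sum_apply]
  refine Finset.sum_congr rfl fun i _ => ?_
  rw [Pi.smul_apply, ← hch]
  have hsmul : (-1 : RepRing n) ^ i * ch (M.torRep hε i) = (-1 : ℤ) ^ i • ch (M.torRep hε i) := by
    simp [zsmul_eq_mul]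
  rw [hsmul, AddMonoidAlgebra.coeff_smul_apply]

end EqModule

end Tor

/-! ### Coordinates are a regular sequence on free modules -/

section Regular

variable {σ : Type*} {k : Type*} [Field k] [DecidableEq σ]

/-- Setting the coordinates in `S` equal to zero. -/
def killVars (k : Type*) [Field k] (S : Finset σ) : MvPolynomial σ k →ₐ[k] MvPolynomial σ k :=
  MvPolynomial.aeval fun s => if s ∈ S then 0 else MvPolynomial.X s

theorem killVars_X_of_notMem {S : Finset σ} {s : σ} (hs : s ∉ S) :
    killVars k S (MvPolynomial.X s) = MvPolynomial.X s := by
  rw [killVars, MvPolynomial.aeval_X, if_neg hs]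

theorem killVars_eq_zero {S : Finset σ} {a : MvPolynomial σ k}
    (ha : a ∈ varIdeal (MvPolynomial.X (R := k)) S) : killVars k S a = 0 := by
  have : varIdeal (MvPolynomial.X (R := k)) S ≤ RingHom.ker (killVars k S) := by
    rw [varIdeal, Ideal.span_le]
    rintro _ ⟨s, hs, rfl⟩
    rw [SetLike.mem_coe, RingHom.mem_ker, killVars, MvPolynomial.aeval_X,
      if_pos (Finset.mem_coe.1 hs)]
  exact this ha

theorem sub_killVars_mem (S : Finset σ) (a : MvPolynomial σ k) :
    a - killVars k S a ∈ varIdeal (MvPolynomial.X (R := k)) S := by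
  rw [← Ideal.Quotient.mk_eq_mk_iff_sub_mem]
  have : Ideal.Quotient.mkₐ k (varIdeal (MvPolynomial.X (R := k)) S) =
      (Ideal.Quotient.mkₐ k (varIdeal (MvPolynomial.X (R := k)) S)).comp (killVars k S) := by
    refine MvPolynomial.algHom_ext fun s => ?_
    rw [AlgHom.comp_apply, killVars, MvPolynomial.aeval_X]
    split_ifs with hs
    · rw [map_zero]
      exact Ideal.Quotient.eq_zero_iff_mem.2 (Ideal.subset_span ⟨s, hs, rfl⟩)
    · rfl
  exact DFunLike.congr_fun this a

variable {N : Type*} [AddCommGroup N] [Module k N]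

theorem rTensor_killVars_smul (S : Finset σ) (a : MvPolynomial σ k)
    (m : MvPolynomial σ k ⊗[k] N) : (killVars k S).toLinearMap.rTensor N (a • m) =
      killVars k S a • (killVars k S).toLinearMap.rTensor N m := by
  induction m using TensorProduct.induction_on with
  | zero => simp
  | tmul b n => simp [TensorProduct.smul_tmul']
  | add x y hx hy => rw [smul_add, map_add, hx, hy, map_add, smul_add]

/-- `killVars` is a projection of the polynomial ring whose kernel is the ideal of the coordinates
in `S`; tensoring with `N` keeps this description. -/
theorem mem_varIdeal_smul_top_iff (S : Finset σ) (m : MvPolynomial σ k ⊗[k] N) :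
    m ∈ varIdeal (MvPolynomial.X (R := k)) S •
      (⊤ : Submodule (MvPolynomial σ k) (MvPolynomial σ k ⊗[k] N)) ↔
      (killVars k S).toLinearMap.rTensor N m = 0 := by
  constructor
  · intro h
    refine Submodule.smul_induction_on h (fun a ha x _ => ?_) fun x y hx hy => ?_
    · rw [rTensor_killVars_smul, killVars_eq_zero ha, zero_smul]
    · rw [map_add, hx, hy, add_zero]
  · intro h
    have key : ∀ m : MvPolynomial σ k ⊗[k] N, m - (killVars k S).toLinearMap.rTensor N m ∈
        varIdeal (MvPolynomial.X (R := k)) S •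
          (⊤ : Submodule (MvPolynomial σ k) (MvPolynomial σ k ⊗[k] N)) := by
      intro m
      induction m using TensorProduct.induction_on with
      | zero => simp
      | tmul b x =>
        have h1 : b ⊗ₜ[k] x - (killVars k S).toLinearMap.rTensor N (b ⊗ₜ x) =
            (b - killVars k S b) • ((1 : MvPolynomial σ k) ⊗ₜ[k] x) := by
          rw [LinearMap.rTensor_tmul, ← TensorProduct.sub_tmul, TensorProduct.smul_tmul',
            smul_eq_mul, mul_one]
          rfl
        rw [h1]
        exact Submodule.smul_mem_smul (sub_killVars_mem S b) trivial
      | add x y hx hy =>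
        rw [map_add, add_sub_add_comm]
        exact add_mem hx hy
    have := key m
    rwa [h, sub_zero] at this

/-- After the coordinates in `S` are killed, multiplication by another coordinate is still
injective, since a free module over a domain is torsion-free. -/
theorem mem_varIdeal_smul_top_of_X_smul_mem {S : Finset σ} {s : σ} (hs : s ∉ S)
    {m : MvPolynomial σ k ⊗[k] N} (h : (MvPolynomial.X s : MvPolynomial σ k) • m ∈
      varIdeal (MvPolynomial.X (R := k)) S •
        (⊤ : Submodule (MvPolynomial σ k) (MvPolynomial σ k ⊗[k] N))) :
    m ∈ varIdeal (MvPolynomial.X (R := k)) S •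
      (⊤ : Submodule (MvPolynomial σ k) (MvPolynomial σ k ⊗[k] N)) := by
  rw [mem_varIdeal_smul_top_iff] at h ⊢
  rw [rTensor_killVars_smul, killVars_X_of_notMem hs] at h
  exact (smul_eq_zero.1 h).resolve_left (MvPolynomial.X_ne_zero s)

end Regular

/-! ### Weights of functions on pairs of matrices -/

section MatRing

variable {n : ℕ} {k : Type u} [Field k]

/-- The weights of the coordinate functions on pairs of matrices. -/
def varWeight : (Fin n × Fin n) ⊕ (Fin n × Fin n) → Weight n
  | Sum.inl (a, b) => (Pi.single b 1 - Pi.single a 1, -1, 0)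
  | Sum.inr (a, b) => (Pi.single b 1 - Pi.single a 1, 0, -1)

theorem prod_zpow_single_sub_single (g : Fin n → kˣ) (a b : Fin n) :
    ∏ i, g i ^ ((Pi.single b 1 - Pi.single a 1 : Fin n → ℤ) i) = g b * (g a)⁻¹ := by
  have h : ∀ c : Fin n, ∏ i, g i ^ ((Pi.single c 1 : Fin n → ℤ) i) = g c := fun c => by
    rw [Finset.prod_eq_single c (fun i _ hi => by rw [Pi.single_eq_of_ne hi, zpow_zero])
      (by simp), Pi.single_eq_same, zpow_one]
  simp only [Pi.sub_apply, zpow_sub, Finset.prod_mul_distrib, Finset.prod_inv_distrib, h]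

theorem matAction_X (s : (Fin n × Fin n) ⊕ (Fin n × Fin n)) (t : Torus n k) :
    matAction n k t (MvPolynomial.X s) = ((varWeight s).eval t : k) • MvPolynomial.X s := by
  rcases s with ⟨a, b⟩ | ⟨a, b⟩
  · simp only [matAction, evalAt, MonoidHom.coe_mk, OneHom.coe_mk, MvPolynomial.aeval_X,
      Sum.elim_inl, matAct_fst, generic, Matrix.of_apply, Algebra.smul_def, varWeight,
      Weight.eval, prod_zpow_single_sub_single]
    congr 2
    simp
    ring
  · simp only [matAction, evalAt, MonoidHom.coe_mk, OneHom.coe_mk, MvPolynomial.aeval_X,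
      Sum.elim_inr, matAct_snd, generic, Matrix.of_apply, Algebra.smul_def, varWeight,
      Weight.eval, prod_zpow_single_sub_single]
    congr 2
    simp
    ring

/-- The weight of the monomial with exponents `d`. -/
def monomialWeight (d : (Fin n × Fin n) ⊕ (Fin n × Fin n) →₀ ℕ) : Weight n :=
  d.sum fun s e => e • varWeight s

theorem monomialWeight_add (d d' : (Fin n × Fin n) ⊕ (Fin n × Fin n) →₀ ℕ) :
    monomialWeight (d + d') = monomialWeight d + monomialWeight d' :=
  Finsupp.sum_add_index' (by simp) (fun s => by simp [add_smul])

theorem monomial_mem_weightSpace (d : (Fin n × Fin n) ⊕ (Fin n × Fin n) →₀ ℕ) (c : k) :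
    MvPolynomial.monomial d c ∈ weightSpace (funRep (matAction n k)) (monomialWeight d) := by
  intro t
  change matAction n k t _ = _
  have key : matAction n k t (MvPolynomial.monomial d 1) =
      ((monomialWeight d).eval t : k) • MvPolynomial.monomial d 1 := by
    induction d using Finsupp.induction_linear with
    | zero =>
      rw [← MvPolynomial.C_apply, map_one, map_one]
      simp [monomialWeight, Weight.eval]
    | add d d' h h' =>
      rw [← one_mul (1 : k), ← MvPolynomial.monomial_mul, map_mul, h, h', smul_mul_smul_comm,
        monomialWeight_add, Weight.eval_add, Units.val_mul]
    | single s e =>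
      rw [monomialWeight, Finsupp.sum_single_index (by simp), ← MvPolynomial.X_pow_eq_monomial,
        map_pow, matAction_X, smul_pow]
      congr 1
      induction e with
      | zero => simp [Weight.eval]
      | succ e ih => rw [pow_succ, ih, succ_nsmul, Weight.eval_add, Units.val_mul]
  rw [← mul_one c, ← smul_eq_mul, ← MvPolynomial.smul_monomial, map_smul, key, smul_comm]

instance fact_isRational_matAction : Fact (IsRational (funRep (matAction n k))) := ⟨by
  refine eq_top_iff.2 fun p _ => ?_
  rw [← MvPolynomial.support_sum_monomial_coeff p]
  exact sum_mem fun d _ => Submodule.mem_iSup_of_mem _ (monomial_mem_weightSpace d _)⟩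

theorem coeff_matAction (t : Torus n k) (p : MatRing n k)
    (d : (Fin n × Fin n) ⊕ (Fin n × Fin n) →₀ ℕ) :
    (matAction n k t p).coeff d = ((monomialWeight d).eval t : k) * p.coeff d := by
  classical
  induction p using MvPolynomial.induction_on' with
  | monomial e c =>
    have : matAction n k t (MvPolynomial.monomial e c) = _ := monomial_mem_weightSpace e c t
    rw [this, MvPolynomial.coeff_smul, MvPolynomial.coeff_monomial, smul_eq_mul]
    split_ifs with h
    · rw [h]
    · simp
  | add p q hp hq => rw [map_add, MvPolynomial.coeff_add, hp, hq, MvPolynomial.coeff_add, mul_add]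

theorem degree_eq_of_monomialWeight (d : (Fin n × Fin n) ⊕ (Fin n × Fin n) →₀ ℕ) :
    (d.degree : ℤ) = -((monomialWeight d).2.1 + (monomialWeight d).2.2) := by
  induction d using Finsupp.induction_linear with
  | zero => simp [monomialWeight]
  | add d d' h h' =>
    rw [map_add, Nat.cast_add, h, h', monomialWeight_add]
    simp only [Prod.fst_add, Prod.snd_add]
    ring
  | single s e =>
    rw [monomialWeight, Finsupp.sum_single_index (by simp)]
    rcases s with ⟨a, b⟩ | ⟨a, b⟩ <;> simp [varWeight]

/-- The weights of the two copies of 𝔾_m determine the total degree of a monomial, so a weight space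
lies in a space of polynomials of bounded degree. -/
instance finite_weightSpace_matAction [Infinite k] (χ : Weight n) :
    Module.Finite k (weightSpace (funRep (matAction n k)) χ) := by
  let m := (-(χ.2.1 + χ.2.2)).toNat
  have hle : weightSpace (funRep (matAction n k)) χ ≤
      MvPolynomial.restrictTotalDegree _ k m := by
    intro p hp
    rw [MvPolynomial.mem_restrictTotalDegree]
    refine Finset.sup_le fun d hd => ?_
    have hχ : monomialWeight d = χ := by
      refine Weight.evalHom_injective (k := k) (MonoidHom.ext fun t => ?_)
      have h1 : matAction n k t p = (χ.eval t : k) • p := hp t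
      have h2 := coeff_matAction t p d
      rw [h1, MvPolynomial.coeff_smul, smul_eq_mul] at h2
      exact (mul_right_cancel₀ (MvPolynomial.mem_support_iff.1 hd) h2).symm
    have h3 := degree_eq_of_monomialWeight d
    rw [hχ] at h3
    have h4 : (d.sum fun _ e => e) = d.degree := rfl
    rw [h4]
    lia
  exact Submodule.finiteDimensional_of_le hle

theorem varIdeal_univ :
    varIdeal (MvPolynomial.X (R := k)) Finset.univ = RingHom.ker (evalZero n k) := by
  classical
  have h0 : ∀ s, evalZero n k (MvPolynomial.X s) = 0 := fun s => by
    rcases s with ⟨a, b⟩ | ⟨a, b⟩ <;> simp [evalZero, evalAt]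
  apply le_antisymm
  · rw [varIdeal, Ideal.span_le]
    rintro _ ⟨s, -, rfl⟩
    exact h0 s
  · intro a ha
    have h1 : (Algebra.ofId k (MatRing n k)).comp (evalZero n k) = killVars k Finset.univ :=
      MvPolynomial.algHom_ext fun s => by
        rw [AlgHom.comp_apply, h0, map_zero, killVars, MvPolynomial.aeval_X,
          if_pos (Finset.mem_univ s)]
    have h2 := sub_killVars_mem (k := k) Finset.univ a
    rw [← h1, AlgHom.comp_apply, show evalZero n k a = 0 from ha, map_zero, sub_zero] at h2
    exact h2

end MatRing

/-! ### Koszul factors and ideals of the representation ring -/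

section Wheel

variable {n : ℕ}

theorem convolution_coeff (a p : RepRing n) : convolution a p.coeff = (a * p).coeff := by
  induction a using AddMonoidAlgebra.induction_linear with
  | zero => simp
  | add a b ha hb =>
    rw [map_add, LinearMap.add_apply, ha, hb, add_mul, AddMonoidAlgebra.coeff_add, Finsupp.coe_add]
  | single w r =>
    have : AddMonoidAlgebra.single w r = r • (AddMonoidAlgebra.single w 1 : RepRing n) := by
      rw [AddMonoidAlgebra.smul_single, smul_eq_mul, mul_one]
    rw [this, map_smul, convolution_single, LinearMap.smul_apply, smul_mul_assoc,
      AddMonoidAlgebra.coeff_smul, Finsupp.coe_smul]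
    congr 1
    funext χ
    rw [shift_apply, AddMonoidAlgebra.coeff_single_mul_eq_mul_coeff (χ - w), one_mul]
    intro ψ _
    rw [eq_sub_iff_add_eq, add_comm]

/-- The coefficient functions of the elements of an ideal. -/
def coeffSubgroup (J : Ideal (RepRing n)) : AddSubgroup (Weight n → ℤ) where
  carrier := {f | ∃ p ∈ J, p.coeff = f}
  add_mem' := by
    rintro _ _ ⟨p, hp, rfl⟩ ⟨q, hq, rfl⟩
    exact ⟨p + q, add_mem hp hq, by rw [AddMonoidAlgebra.coeff_add, Finsupp.coe_add]⟩
  zero_mem' := ⟨0, zero_mem _, rfl⟩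
  neg_mem' := by
    rintro _ ⟨p, hp, rfl⟩
    exact ⟨-p, neg_mem hp, rfl⟩

theorem convolution_mem_coeffSubgroup {J : Ideal (RepRing n)} (a : RepRing n) {f : Weight n → ℤ}
    (hf : f ∈ coeffSubgroup J) : convolution a f ∈ coeffSubgroup J := by
  obtain ⟨p, hp, rfl⟩ := hf
  exact ⟨a * p, J.mul_mem_left a hp, (convolution_coeff a p).symm⟩

theorem convolution_mem_coeffSubgroup_of_mem {J : Ideal (RepRing n)} {a : RepRing n} (ha : a ∈ J)
    (p : RepRing n) : convolution a p.coeff ∈ coeffSubgroup J :=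
  ⟨a * p, J.mul_mem_right p ha, (convolution_coeff a p).symm⟩

theorem mem_of_coeff_mem_coeffSubgroup {J : Ideal (RepRing n)} {p : RepRing n}
    (h : (p.coeff : Weight n → ℤ) ∈ coeffSubgroup J) : p ∈ J := by
  obtain ⟨q, hq, hqp⟩ := h
  rwa [← AddMonoidAlgebra.coeff_injective (DFunLike.coe_injective hqp)]

/-- The element `1 - w_s`, where `w_s` is the class of the weight of the coordinate `s`. -/
abbrev koszulFactor (s : (Fin n × Fin n) ⊕ (Fin n × Fin n)) : RepRing n :=
  1 - AddMonoidAlgebra.single (varWeight s) 1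

variable {k : Type u} [Field k]

theorem smul_mem_of_mem_varIdeal {A : Type*} [CommRing A] {σ : Type*} {X : σ → A}
    {N : Type*} [AddCommGroup N] [Module A N] {P Q : Submodule A N} {S : Finset σ}
    (h : ∀ s ∈ S, ∀ q ∈ Q, X s • q ∈ P) (a : A) (ha : a ∈ varIdeal X S) (q : N) (hq : q ∈ Q) :
    a • q ∈ P := by
  induction ha using Submodule.span_induction with
  | mem a ha =>
    obtain ⟨s, hs, rfl⟩ := ha
    exact h s hs q hq
  | zero => rw [zero_smul]; exact zero_mem _
  | add a b _ _ ha hb => rw [add_smul]; exact add_mem ha hb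
  | smul a b _ hb => rw [smul_assoc]; exact P.smul_mem a hb

namespace EqModule

variable [Infinite k] {N : EqModule (matAction n k)} {P Q : Submodule (MatRing n k) N.carrier}

/-- The coordinate `s` acts as zero on `Q ⧸ P`. -/
abbrev KilledBy (N : EqModule (matAction n k)) (s : (Fin n × Fin n) ⊕ (Fin n × Fin n))
    (P Q : Submodule (MatRing n k) N.carrier) : Prop :=
  ∀ q ∈ Q, (MvPolynomial.X s : MatRing n k) • q ∈ P

/-- When every coordinate acts as zero the subquotient is finite-dimensional over `k`, so its
Hilbert function is the coefficient function of a Laurent polynomial. -/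
theorem exists_coeff_eq_hilb (hN : IsRational N.rho) (hP : N.Stable P) (h : FGOver P Q)
    (hk : ∀ s, N.KilledBy s P Q) : ∃ p : RepRing n, p.coeff = N.hilb P Q := by
  have hfin := finite_setOf_relDim_ne_zero hN (P := P.restrictScalars k)
    (Q := Q.restrictScalars k) hP (h.restrictScalars (evalZero n k) fun a ha q hq =>
      smul_mem_of_mem_varIdeal (X := MvPolynomial.X) (S := Finset.univ) (fun s _ => hk s) a (by rwa [varIdeal_univ]) q hq)
  exact ⟨AddMonoidAlgebra.ofCoeff (Finsupp.ofSupportFinite (N.hilb P Q)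
    (hfin.subset fun χ hχ h0 => hχ (congrArg Nat.cast h0))), rfl⟩

variable (s : (Fin n × Fin n) ⊕ (Fin n × Fin n))

theorem convolution_koszulFactor_hilb (hN : IsRational N.rho) (hP : N.Stable P) (hQ : N.Stable Q)
    (hPQ : P ≤ Q) (h : FGOver P Q) : convolution (koszulFactor s) (N.hilb P Q) =
      N.hilb (P ⊔ smulImage (MvPolynomial.X s) Q) Q -
        convolution (AddMonoidAlgebra.single (varWeight s) 1)
          (N.hilb P (Q ⊓ P.comap (LinearMap.lsmul _ _ (MvPolynomial.X s)))) := by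
  rw [map_sub, map_one, convolution_single, LinearMap.sub_apply, Module.End.one_apply,
    hilb_sub_shift (matAction_X s) hN hP hQ hPQ h]

/-- Only `s` acts, so kernel and cokernel of `X s` are killed by all coordinates and have Laurent
polynomial Hilbert functions. -/
theorem exists_coeff_eq_convolution_hilb (hN : IsRational N.rho) (hP : N.Stable P)
    (hQ : N.Stable Q) (hPQ : P ≤ Q) (h : FGOver P Q) (hk : ∀ v ≠ s, N.KilledBy v P Q) :
    ∃ p : RepRing n, p.coeff = convolution (koszulFactor s) (N.hilb P Q) := by
  have hs := shift_lsmul (matAction_X s) N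
  have h1 : P ≤ Q ⊓ P.comap (LinearMap.lsmul _ _ (MvPolynomial.X s)) :=
    le_inf hPQ fun v hv => P.smul_mem _ hv
  obtain ⟨p, hp⟩ := exists_coeff_eq_hilb (N := N) hN (hP.sup (hQ.map hs))
    (h.of_le le_sup_left (sup_le hPQ (smulImage_le _ _))) fun v q hq => by
      by_cases hv : v = s
      · exact Submodule.mem_sup_right ⟨q, hq, by rw [hv]; rfl⟩
      · exact Submodule.mem_sup_left (hk v hv q hq)
  obtain ⟨p', hp'⟩ := exists_coeff_eq_hilb (N := N) hN hP (h.restrict h1 inf_le_left)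
    fun v q hq => by
      by_cases hv : v = s
      · rw [hv]; exact hq.2
      · exact hk v hv q hq.1
  refine ⟨p - AddMonoidAlgebra.single (varWeight s) 1 * p', ?_⟩
  rw [convolution_koszulFactor_hilb s hN hP hQ hPQ h, ← hp, ← hp', convolution_coeff]
  rfl

variable {s} {s' : (Fin n × Fin n) ⊕ (Fin n × Fin n)} {c : MatRing n k}
  (hc : killVars k (Finset.univ \ {s, s'}) c = MvPolynomial.X s * MvPolynomial.X s')
include hc

/-- Filter Q ⧸ P by R = P + X_s Q. Then R ⧸ P is killed by X_{s'} and Q ⧸ R by X_s. One Koszul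
factor turns each Hilbert function into a Laurent polynomial, and the other multiplies it into the
ideal. -/
theorem koszul_hilb_mem_of_killedBy (hN : IsRational N.rho)
    (hcN : ∀ m : N.carrier, c • m = 0) (hP : N.Stable P) (hQ : N.Stable Q) (hPQ : P ≤ Q)
    (h : FGOver P Q) (hk : ∀ v, v ≠ s → v ≠ s' → N.KilledBy v P Q) :
    convolution (koszulFactor s * koszulFactor s') (N.hilb P Q) ∈
      coeffSubgroup (Ideal.span {koszulFactor s, koszulFactor s'}) := by
  have hs := shift_lsmul (matAction_X s) N
  set R := P ⊔ smulImage (MvPolynomial.X s) Q with hR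
  have hRs : N.Stable R := hP.sup (hQ.map hs)
  have hPR : P ≤ R := le_sup_left
  have hRQ : R ≤ Q := sup_le hPQ (smulImage_le _ _)
  have hprod : ∀ q ∈ Q, (MvPolynomial.X s' : MatRing n k) • (MvPolynomial.X s : MatRing n k) • q ∈
      P := by
    intro q hq
    -- The element `c` differs from X_s X_{s'} by a combination of the other coordinates, which act
    -- as zero on Q ⧸ P, and `c` acts as zero too.
    have h1 := smul_mem_of_mem_varIdeal (X := MvPolynomial.X) (P := P) (Q := Q)
      (S := Finset.univ \ {s, s'}) (fun v hv => by
        rw [Finset.mem_sdiff, Finset.mem_insert, Finset.mem_singleton, not_or] at hv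
        exact hk v hv.2.1 hv.2.2) _ (sub_killVars_mem (k := k) _ c) q hq
    rw [hc, sub_smul, hcN, zero_sub, neg_mem_iff, mul_comm, mul_smul] at h1
    exact h1
  obtain ⟨p, hp⟩ := exists_coeff_eq_convolution_hilb s hN hP hRs hPR (h.restrict hPR hRQ)
    fun v hv q hq => by
      by_cases hv' : v = s'
      · obtain ⟨a, ha, _, ⟨b, hb, rfl⟩, rfl⟩ := Submodule.mem_sup.1 hq
        rw [hv', smul_add]
        exact add_mem (P.smul_mem _ ha) (hprod b hb)
      · exact hk v hv hv' q (hRQ hq)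
  obtain ⟨p', hp'⟩ := exists_coeff_eq_convolution_hilb s' hN hRs hQ hRQ (h.of_le hPR hRQ)
    fun v hv q hq => by
      by_cases hv' : v = s
      · exact Submodule.mem_sup_right ⟨q, hq, by rw [hv']; rfl⟩
      · exact Submodule.mem_sup_left (hk v hv' hv q hq)
  rw [hilb_add hN hP hQ hPR hRQ h, map_add]
  refine add_mem ?_ ?_
  · rw [mul_comm, map_mul, Module.End.mul_apply, ← hp]
    exact convolution_mem_coeffSubgroup_of_mem (Ideal.subset_span (by simp)) p
  · rw [map_mul, Module.End.mul_apply, ← hp']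
    exact convolution_mem_coeffSubgroup_of_mem (Ideal.subset_span (by simp)) p'

/-- Each factor for `v ∈ S` is traded for the kernel and cokernel of `X v`, on which `v` acts as
zero. `P` and `Q` must vary in the induction because these are new subquotients. -/
theorem koszul_hilb_mem (hN : IsRational N.rho) (hcN : ∀ m : N.carrier, c • m = 0)
    (S : Finset ((Fin n × Fin n) ⊕ (Fin n × Fin n))) (hP : N.Stable P) (hQ : N.Stable Q)
    (hPQ : P ≤ Q) (h : FGOver P Q) (hk : ∀ v ∉ S, v ≠ s → v ≠ s' → N.KilledBy v P Q) :
    convolution ((∏ v ∈ S, koszulFactor v) * (koszulFactor s * koszulFactor s')) (N.hilb P Q) ∈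
      coeffSubgroup (Ideal.span {koszulFactor s, koszulFactor s'}) := by
  induction S using Finset.induction_on generalizing P Q with
  | empty =>
    rw [Finset.prod_empty, one_mul]
    exact koszul_hilb_mem_of_killedBy hc hN hcN hP hQ hPQ h fun v => hk v (Finset.notMem_empty v)
  | insert v S hv ih =>
    have hs := shift_lsmul (matAction_X v) N
    have h1 : P ≤ Q ⊓ P.comap (LinearMap.lsmul _ _ (MvPolynomial.X v)) :=
      le_inf hPQ fun v hv => P.smul_mem _ hv
    have key : ∀ a, convolution (koszulFactor v * a) (N.hilb P Q) =
        convolution a (N.hilb (P ⊔ smulImage (MvPolynomial.X v) Q) Q) -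
          convolution (AddMonoidAlgebra.single (varWeight v) 1) (convolution a
            (N.hilb P (Q ⊓ P.comap (LinearMap.lsmul _ _ (MvPolynomial.X v))))) := fun a => by
      rw [mul_comm, map_mul, Module.End.mul_apply,
        convolution_koszulFactor_hilb v hN hP hQ hPQ h, map_sub, ← Module.End.mul_apply,
        ← map_mul, mul_comm, map_mul, Module.End.mul_apply]
    rw [Finset.prod_insert hv, mul_assoc, key]
    refine sub_mem (ih (hP.sup (hQ.map hs)) hQ (sup_le hPQ (smulImage_le _ _))
      (h.of_le le_sup_left (sup_le hPQ (smulImage_le _ _))) ?_)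
      (convolution_mem_coeffSubgroup _ (ih hP (hQ.inf (hP.comap hs)) h1
        (h.restrict h1 inf_le_left) ?_))
    · intro u hu hus hus' q hq
      by_cases huv : u = v
      · exact Submodule.mem_sup_right ⟨q, hq, by rw [huv]; rfl⟩
      · exact Submodule.mem_sup_left (hk u (by simp [huv, hu]) hus hus' q hq)
    · intro u hu hus hus' q hq
      by_cases huv : u = v
      · rw [huv]; exact hq.2
      · exact hk u (by simp [huv, hu]) hus hus' q hq.1

end EqModule

end Wheel

/-! ### The pullback to the origin and the wheel conditions -/

section Main

variable {n : ℕ} {k : Type u} [Field k]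

namespace EqModule

variable [Infinite k]

/-- The Koszul formula for the class of `Tor`. -/
theorem coeff_torClass_matAction {M : EqModule (matAction n k)} (hM : IsRational M.rho)
    [Module.Finite (MatRing n k) M.carrier] :
    ((M.torClass (evalZero_matAction n k)).coeff : Weight n → ℤ) =
      convolution (∏ s, koszulFactor s) (M.hilb ⊥ ⊤) := by
  classical
  obtain ⟨h1, h2, h3⟩ := (M.resComplex hM).euler_varIdeal (X := MvPolynomial.X) matAction_X
    (fun S s hs i m => mem_varIdeal_smul_top_of_X_smul_mem hs) (resComplex_fgOver hM)
    (resComplex_exact hM) Finset.univ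
  rw [← resComplex_relHilb hM, ← h3 _ (Nat.lt_succ_self _)]
  rw [varIdeal_univ] at h1 h2 ⊢
  exact coeff_torClass (evalZero_matAction n k) hM h1 fun i hi => h2 i hi

theorem hilb_of_isShortExact {A : Type u} [CommRing A] [Algebra k A]
    {α : Torus n k →* (A →ₐ[k] A)} [Fact (IsRational (funRep α))]
    [∀ χ, Module.Finite k (weightSpace (funRep α) χ)] {F G H : EqModule α}
    (h : IsShortExact F G H) (hF : IsRational F.rho) (hG : IsRational G.rho)
    [Module.Finite A G.carrier] : G.hilb ⊥ ⊤ = F.hilb ⊥ ⊤ + H.hilb ⊥ ⊤ := by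
  obtain ⟨f, g, hf, hg, hi, he, hs⟩ := h
  have hf' : F.Shift G 0 f := isShift_zero hf
  rw [hilb_add hG stable_bot stable_top bot_le le_top (Q := LinearMap.range f)
    ⟨⊤, Module.Finite.fg_top, by simp⟩]
  congr 1
  · refine (hilb_eq hF hf' stable_top stable_bot ?_ ?_).symm
    · rw [sup_bot_eq, LinearMap.range_eq_map]
    · rw [top_inf_eq]
      exact LinearMap.ker_eq_bot.2 hi
  · refine hilb_eq hG (isShift_zero hg) stable_top stable_bot ?_ ?_
    · rw [sup_bot_eq, ← LinearMap.range_eq_map]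
      exact LinearMap.range_eq_top.2 hs
    · rw [top_inf_eq]
      exact he.linearMap_ker_eq

end EqModule

theorem EqCoh.isRational [Infinite k] {A : Type u} [CommRing A] [Algebra k A]
    {α : Torus n k →* (A →ₐ[k] A)} (F : EqCoh α) : IsRational F.rho :=
  isRational_of_algebraic F.algebraic

/-- By the Koszul formula the class depends linearly on the Hilbert function, so no long exact
sequence of Tor is needed. -/
theorem torClass_of_isShortExact [Infinite k] {F G H : EqCoh (matAction n k)}
    (h : IsShortExact F.toEqModule G.toEqModule H.toEqModule) :
    G.toEqModule.torClass (evalZero_matAction n k) =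
      F.toEqModule.torClass (evalZero_matAction n k) +
        H.toEqModule.torClass (evalZero_matAction n k) := by
  have := F.finite
  have := G.finite
  have := H.finite
  refine AddMonoidAlgebra.coeff_injective (DFunLike.coe_injective ?_)
  rw [AddMonoidAlgebra.coeff_add, Finsupp.coe_add, EqModule.coeff_torClass_matAction F.isRational,
    EqModule.coeff_torClass_matAction G.isRational, EqModule.coeff_torClass_matAction H.isRational,
    EqModule.hilb_of_isShortExact h F.isRational G.isRational, map_add]

/-- The pullback to the origin on Grothendieck groups. -/
def pullbackToOrigin [Infinite k] : KMat n k →+ RepRing n :=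
  QuotientAddGroup.lift (relations (matAction n k))
    (FreeAbelianGroup.lift fun F => F.toEqModule.torClass (evalZero_matAction n k)) <| by
      rw [relations, AddSubgroup.closure_le]
      rintro _ ⟨F, G, H, h, rfl⟩
      change FreeAbelianGroup.lift _ _ = 0
      rw [map_sub, map_sub, FreeAbelianGroup.lift_apply_of, FreeAbelianGroup.lift_apply_of,
        FreeAbelianGroup.lift_apply_of, torClass_of_isShortExact h]
      abel

theorem isPullbackToOrigin_pullbackToOrigin [Infinite k] :
    IsPullbackToOrigin (pullbackToOrigin (n := n) (k := k)) := fun F =>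
  FreeAbelianGroup.lift_apply_of _ F

/-- Apply `EqModule.koszul_hilb_mem` to the whole module, with `S` all coordinates except `s` and
`s'`. Since `s ≠ s'`, the product there is the full Koszul product. -/
theorem torClass_mem_of_smul_eq_zero [Infinite k] {M : EqModule (matAction n k)}
    (hM : IsRational M.rho) [Module.Finite (MatRing n k) M.carrier]
    {s s' : (Fin n × Fin n) ⊕ (Fin n × Fin n)} (hss' : s ≠ s') {c : MatRing n k}
    (hc : killVars k (Finset.univ \ {s, s'}) c = MvPolynomial.X s * MvPolynomial.X s')
    (hcM : ∀ m : M.carrier, c • m = 0) :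
    M.torClass (evalZero_matAction n k) ∈ Ideal.span {koszulFactor s, koszulFactor s'} := by
  refine mem_of_coeff_mem_coeffSubgroup ?_
  have h := EqModule.koszul_hilb_mem hc hM hcM (Finset.univ \ {s, s'}) EqModule.stable_bot
    EqModule.stable_top bot_le ⟨⊤, Module.Finite.fg_top, by simp⟩ fun v hv h1 h2 =>
      absurd (by simp [h1, h2]) hv
  rwa [← Finset.prod_pair (f := koszulFactor) hss', Finset.prod_sdiff (Finset.subset_univ _),
    ← EqModule.coeff_torClass_matAction hM] at h

/-- Functions carry the dual weight: the coordinate X_{ab} has weight z_b / (q₁ z_a), so its Koszul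
factor is a unit multiple of z_b - q₁ z_a. -/
theorem koszulFactor_inl (a b : Fin n) : koszulFactor (Sum.inl (a, b)) =
    AddMonoidAlgebra.single (-(Pi.single a 1, 1, 0)) (-1) * (z b - q₁ * z a) := by
  have h₁ : -(Pi.single a 1, 1, 0) + (Pi.single b 1, 0, 0) =
      (varWeight (Sum.inl (a, b)) : Weight n) := by
    simp [varWeight, neg_add_eq_sub]
  have h₂ : -(Pi.single a 1, 1, 0) + ((0, 1, 0) + (Pi.single a 1, 0, 0)) = (0 : Weight n) := by
    simp
  rw [koszulFactor, z, q₁, z, mul_sub, AddMonoidAlgebra.single_mul_single,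
    AddMonoidAlgebra.single_mul_single, AddMonoidAlgebra.single_mul_single, h₁, h₂]
  simp [AddMonoidAlgebra.one_def, AddMonoidAlgebra.single_neg, neg_add_eq_sub]

theorem koszulFactor_inr (a b : Fin n) : koszulFactor (Sum.inr (a, b)) =
    AddMonoidAlgebra.single (-(Pi.single a 1, 0, 1)) (-1) * (z b - q₂ * z a) := by
  have h₁ : -(Pi.single a 1, 0, 1) + (Pi.single b 1, 0, 0) =
      (varWeight (Sum.inr (a, b)) : Weight n) := by
    simp [varWeight, neg_add_eq_sub]
  have h₂ : -(Pi.single a 1, 0, 1) + ((0, 0, 1) + (Pi.single a 1, 0, 0)) = (0 : Weight n) := by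
    simp
  rw [koszulFactor, z, q₂, z, mul_sub, AddMonoidAlgebra.single_mul_single,
    AddMonoidAlgebra.single_mul_single, AddMonoidAlgebra.single_mul_single, h₁, h₂]
  simp [AddMonoidAlgebra.one_def, AddMonoidAlgebra.single_neg, neg_add_eq_sub]

theorem koszulFactor_inl_mem {J : Ideal (RepRing n)} {a b : Fin n} (h : z b - q₁ * z a ∈ J) :
    koszulFactor (Sum.inl (a, b)) ∈ J := by
  rw [koszulFactor_inl]
  exact J.mul_mem_left _ h

theorem koszulFactor_inr_mem {J : Ideal (RepRing n)} {a b : Fin n} (h : z b - q₂ * z a ∈ J) :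
    koszulFactor (Sum.inr (a, b)) ∈ J := by
  rw [koszulFactor_inr]
  exact J.mul_mem_left _ h

/-- The commutator entries, in the coordinate ring. -/
theorem commutator_apply (i l : Fin n) :
    ((generic n k).1 * (generic n k).2 - (generic n k).2 * (generic n k).1) i l =
      ∑ m, MvPolynomial.X (Sum.inl (i, m)) * MvPolynomial.X (Sum.inr (m, l)) -
        ∑ m, MvPolynomial.X (Sum.inr (i, m)) * MvPolynomial.X (Sum.inl (m, l)) := by
  simp [generic, Matrix.mul_apply]

/-- In the sum for XY only the summand m = j survives. A surviving summand of YX would need Y_{im}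
to be Y_{jl}, which i ≠ j excludes. -/
theorem killVars_commutator_inl_inr {i j l : Fin n} (hij : i ≠ j) :
    killVars k (Finset.univ \ {Sum.inl (i, j), Sum.inr (j, l)})
      (((generic n k).1 * (generic n k).2 - (generic n k).2 * (generic n k).1) i l) =
      MvPolynomial.X (Sum.inl (i, j)) * MvPolynomial.X (Sum.inr (j, l)) := by
  rw [commutator_apply, map_sub, map_sum, map_sum, Finset.sum_eq_single j, Finset.sum_eq_zero]
  · simp [killVars]
  · intro m _
    simp [killVars, hij]
  · intro m _ hm
    simp [killVars, hm]
  · simp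

theorem killVars_commutator_inr_inl {i j l : Fin n} (hij : i ≠ j) :
    killVars k (Finset.univ \ {Sum.inr (i, j), Sum.inl (j, l)})
      (-((generic n k).1 * (generic n k).2 - (generic n k).2 * (generic n k).1) i l) =
      MvPolynomial.X (Sum.inr (i, j)) * MvPolynomial.X (Sum.inl (j, l)) := by
  rw [commutator_apply, neg_sub, map_sub, map_sum, map_sum, Finset.sum_eq_single j,
    Finset.sum_eq_zero]
  · simp [killVars]
  · intro m _
    simp [killVars, hij]
  · intro m _ hm
    simp [killVars, hm]
  · simp

/-- The direct image on `gl_n ⊕ gl_n` of an equivariant coherent sheaf on `Comm_n`. -/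
abbrev pushComm (F : EqCoh (commAction n k)) : EqCoh (matAction n k) :=
  pushforwardObj (Ideal.Quotient.mkₐ k (commIdeal n k)) (Ideal.Quotient.mkₐ_surjective k _)
    (fun _ _ => rfl) F

theorem commutator_smul_pushComm (F : EqCoh (commAction n k)) (i l : Fin n)
    (m : (pushComm F).carrier) :
    ((generic n k).1 * (generic n k).2 - (generic n k).2 * (generic n k).1) i l • m = 0 := by
  have h : Ideal.Quotient.mk (commIdeal n k)
      (((generic n k).1 * (generic n k).2 - (generic n k).2 * (generic n k).1) i l) = 0 :=
    Ideal.Quotient.eq_zero_iff_mem.2 (Ideal.subset_span ⟨(i, l), rfl⟩)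
  exact (congrArg (fun a : CommutingRing n k => (a • (m : F.carrier) : F.carrier)) h).trans
    (zero_smul (CommutingRing n k) (m : F.carrier))

theorem pullbackToOrigin_pPush_mem [Infinite k] {J : Ideal (RepRing n)}
    (hJ : ∀ F : EqCoh (commAction n k),
      (pushComm F).toEqModule.torClass (evalZero_matAction n k) ∈ J) (x : KComm n k) :
    pullbackToOrigin (pPush n k x) ∈ J := by
  have h : ∀ F : EqCoh (commAction n k), pullbackToOrigin (pPush n k (KGroup.cls F)) ∈ J :=
    fun F => by
      have : pullbackToOrigin (pPush n k (KGroup.cls F)) =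
          (pushComm F).toEqModule.torClass (evalZero_matAction n k) :=
        isPullbackToOrigin_pullbackToOrigin (pushComm F)
      rw [this]
      exact hJ F
  obtain ⟨x, rfl⟩ := QuotientAddGroup.mk_surjective x
  induction x using FreeAbelianGroup.induction_on with
  | zero =>
    rw [QuotientAddGroup.mk_zero, map_zero, map_zero]
    exact zero_mem _
  | of F => exact h F
  | neg F hF =>
    rw [QuotientAddGroup.mk_neg, map_neg, map_neg]
    exact neg_mem hF
  | add x y hx hy =>
    rw [QuotientAddGroup.mk_add, map_add, map_add]
    exact add_mem hx hy

end Main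

end WheelCondition

end

open WheelCondition in
theorem theorem2p5 {k : Type*} [Field k] [IsAlgClosed k] (n : ℕ) :
    ∃ r₀ : KMat n k →+ RepRing n, IsPullbackToOrigin r₀ ∧
      ∀ i j l : Fin n, i ≠ j → j ≠ l → i ≠ l → ∀ x : KComm n k,
        r₀ (pPush n k x) ∈ Ideal.span {z l - q₁ * z j, z j - q₂ * z i} ∧
        r₀ (pPush n k x) ∈ Ideal.span {z l - q₂ * z j, z j - q₁ * z i} := by
  have : Infinite k := IsAlgClosed.instInfinite
  refine ⟨pullbackToOrigin, isPullbackToOrigin_pullbackToOrigin, fun i j l hij _ _ x => ⟨?_, ?_⟩⟩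
  -- The first ideal comes from the monomial Y_{ij} X_{jl} in entry (i, l) of YX - XY, the second
  -- from X_{ij} Y_{jl} in the same entry of XY - YX.
  · refine pullbackToOrigin_pPush_mem (fun F => ?_) x
    have := (pushComm F).finite
    refine Ideal.span_le.2 (Set.pair_subset ?_ ?_) (torClass_mem_of_smul_eq_zero
      (pushComm F).isRational (s := Sum.inr (i, j)) (s' := Sum.inl (j, l)) Sum.inr_ne_inl
      (killVars_commutator_inr_inl hij) fun m => ?_)
    · exact koszulFactor_inr_mem (Ideal.subset_span (by simp))
    · exact koszulFactor_inl_mem (Ideal.subset_span (by simp))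
    · rw [neg_smul, commutator_smul_pushComm, neg_zero]
  · refine pullbackToOrigin_pPush_mem (fun F => ?_) x
    have := (pushComm F).finite
    refine Ideal.span_le.2 (Set.pair_subset ?_ ?_) (torClass_mem_of_smul_eq_zero
      (pushComm F).isRational (s := Sum.inl (i, j)) (s' := Sum.inr (j, l)) Sum.inl_ne_inr
      (killVars_commutator_inl_inr hij) fun m => ?_)
    · exact koszulFactor_inl_mem (Ideal.subset_span (by simp))
    · exact koszulFactor_inr_mem (Ideal.subset_span (by simp))
    · exact commutator_smul_pushComm F i l m
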